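/- All Hilbert spaces are finite-dimensional and logarithms are to base 2. Let $\mathcal X$ be a finite alphabet and, for each $x\in\mathcal X$, let $U^{x}_{B'\to BE}$ be an isometry, with isometric channel $\mathcal U^x(\cdot)=U^x(\cdot)(U^x)^\dagger$. The family $\{\mathcal U^{x}_{B'\to BE}\}_{x\in\mathcal X}$ is called an isometric wiretap memory cell. **Private reading.** For $n\ge 1$, an $(n,K,\varepsilon,\delta)$ private reading protocol consists of codewords $x^n(k)\in\mathcal X^n$ for $k\in\{1,\dots,K\}$, a transmitter state $\rho_{L_1B_1'}$, channels $\mathcal A^i_{L_iB_i\to L_{i+1}B'_{i+1}}$ for $1\le i\le n-1$ (where the $L_i$ are finite-dimensional systems of arbitrary size), and a measurement $\{\Lambda^{(k)}_{L_nB_n}\}_{k=1}^K$, such that the states $$\rho^{(k)}_{L_nB_nE^n}=\bigl(\mathcal U^{x_n(k)}_{B_n'\to B_nE_n}\circ\mathcal A^{n-1}\circ\cdots\circ\mathcal A^1\circ\mathcal U^{x_1(k)}_{B_1'\to B_1E_1}\bigr)(\rho_{L_1B_1'})$$ satisfy $$\frac1K\sum_k\operatorname{Tr}\{\Lambda^{(k)}\rho^{(k)}_{L_nB_n}\}\ge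 1-\varepsilon\qquad\text{and}\qquad \frac1K\sum_k\frac12\bigl\|\rho^{(k)}_{E^n}-\tau_{E^n}\bigr\|_1\le\delta$$ for some fixed state $\tau_{E^n}$. A real number $R$ is a strong converse rate if for all $\varepsilon,\delta\ge 0$ with $\varepsilon+2\delta<1$ and all $\delta'>0$, for all sufficiently large $n$ there is no $(n,K,\varepsilon,\delta)$ private reading protocol with $K\ge 2^{n(R+\delta')}$. The strong converse private reading capacity $\widetilde P^{\mathrm{read}}$ of the memory cell is the infimum of all strong converse rates. **Bidirectional max-relative entropy of entanglement.** For a bipartite state $\rho_{AB}$ let $$E_{\max}(A;B)_\rho=\inf_{\sigma_{AB}}D_{\max}(\rho_{AB}\|\sigma_{AB}),\qquad D_{\max}(\rho\|\sigma)=\inf\{\lambda\in\mathbb R:\rho\le 2^\lambda\sigma\},$$ where $\sigma_{AB}$ ranges over the separable states and $\inf\emptyset=+\infty$. For a bidirectional channel $\mathcal N_{A'B'\to AB}$ let $$E^{2\to2}_{\max}(\mathcal N)=\sup_{\psi,\varphi}E_{\max}(S_AA;BS_B)_{\omega},\qquad \omega=\mathcal N_{A'B'\to AB}(\psi_{S_AA'}\otimes\varphi_{B'S_B}),$$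 where $\psi$ and $\varphi$ range over pure states and $S_A\simeq A'$, $S_B\simeq B'$. **Theorem.** Let $X$ be a system with orthonormal basis $\{|x\rangle\}_{x\in\mathcal X}$ and put $$U_{XB'\to XBE}=\sum_{x\in\mathcal X}|x\rangle\langle x|_X\otimes U^{x}_{B'\to BE},\qquad \mathcal N_{XB'\to XB}(\cdot)=\operatorname{Tr}_E\{U_{XB'\to XBE}(\cdot)(U_{XB'\to XBE})^\dagger\}.$$ Then $$\widetilde P^{\mathrm{read}}\bigl(\{\mathcal U^{x}_{B'\to BE}\}_{x\in\mathcal X}\bigr)\le E^{2\to2}_{\max}(\mathcal N_{XB'\to XB}),$$ where $X$ is Alice's system and $B'$, $B$ are Bob's systems. -/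

import Mathlib

noncomputable section

namespace PrivateReading

open scoped Kronecker ComplexOrder

/-! A finite type `I` stands for the quantum system with Hilbert space `ℂ^I`; operators are
matrices, and the composite of the systems `I` and `J` is `I × J`. -/

/-- Density operators: positive semi-definite with unit trace. -/
def IsDensity {I : Type*} [Fintype I] (ρ : Matrix I I ℂ) : Prop :=
  ρ.PosSemidef ∧ ρ.trace = 1

/-- The operator `|ψ⟩⟨ψ|`. -/
def ketbra {I : Type*} (ψ : I → ℂ) : Matrix I I ℂ := Matrix.vecMulVec ψ (star ψ)

/-- Unit vectors of `ℂ^I`. -/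
def IsUnitVector {I : Type*} [Fintype I] (ψ : I → ℂ) : Prop := ∑ i, ‖ψ i‖ ^ 2 = 1

/-- Partial trace over the first system. -/
def traceFst {I J : Type*} [Fintype I] (ρ : Matrix (I × J) (I × J) ℂ) : Matrix J J ℂ :=
  Matrix.of fun j j' => ∑ i, ρ (i, j) (i, j')

/-- Partial trace over the second system. -/
def traceSnd {I J : Type*} [Fintype J] (ρ : Matrix (I × J) (I × J) ℂ) : Matrix I I ℂ :=
  Matrix.of fun i i' => ∑ j, ρ (i, j) (i', j)

/-- The trace norm: the sum of the singular values. -/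
def traceNorm {I : Type*} [Fintype I] [DecidableEq I] (ρ : Matrix I I ℂ) : ℝ :=
  ∑ i, √((Matrix.isHermitian_conjTranspose_mul_self ρ).eigenvalues i)

/-- `(id_R ⊗ Φ)(ρ)`. -/
def ampliation {R I O : Type*} (Φ : Matrix I I ℂ →ₗ[ℂ] Matrix O O ℂ)
    (ρ : Matrix (R × I) (R × I) ℂ) : Matrix (R × O) (R × O) ℂ :=
  Matrix.of fun p q => Φ (Matrix.of fun i j => ρ (p.1, i) (q.1, j)) p.2 q.2

/-- Quantum channels: completely positive and trace-preserving maps. -/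
structure IsChannel {I O : Type*} [Fintype I] [Fintype O]
    (Φ : Matrix I I ℂ →ₗ[ℂ] Matrix O O ℂ) : Prop where
  completelyPositive : ∀ (k : ℕ) (ρ : Matrix (Fin k × I) (Fin k × I) ℂ),
    ρ.PosSemidef → (ampliation Φ ρ).PosSemidef
  tracePreserving : ∀ ρ : Matrix I I ℂ, (Φ ρ).trace = ρ.trace

/-- The map `ρ ↦ V ρ V†`; an isometric channel if `V† V = 1`. -/
def conjChannel {I O : Type*} [Fintype I] (V : Matrix O I ℂ) :
    Matrix I I ℂ →ₗ[ℂ] Matrix O O ℂ where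
  toFun ρ := V * ρ * V.conjTranspose
  map_add' ρ σ := by rw [Matrix.mul_add, Matrix.add_mul]
  map_smul' c ρ := by simp

/-! ### Entanglement -/

/-- Separable states of a bipartite system `I : J`. -/
def IsSeparable {I J : Type*} [Fintype I] [Fintype J] (σ : Matrix (I × J) (I × J) ℂ) : Prop :=
  ∃ (m : ℕ) (p : Fin m → ℝ) (ω : Fin m → Matrix I I ℂ) (τ : Fin m → Matrix J J ℂ),
    (∀ x, 0 ≤ p x) ∧ ∑ x, p x = 1 ∧ (∀ x, IsDensity (ω x)) ∧ (∀ x, IsDensity (τ x)) ∧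
    σ = ∑ x, p x • (ω x ⊗ₖ τ x)

/-- Max-relative entropy `D_max(ρ‖σ) = inf {λ : ρ ≤ 2^λ σ}` (with `inf ∅ = +∞`). -/
def maxRelEntropy {I : Type*} (ρ σ : Matrix I I ℂ) : EReal :=
  ⨅ (t : ℝ) (_ : ((2 : ℝ) ^ t • σ - ρ).PosSemidef), (t : EReal)

/-- Max-relative entropy of entanglement `E_max(I;J)_ρ` of a bipartite state. -/
def maxRelEntanglement {I J : Type*} [Fintype I] [Fintype J]
    (ρ : Matrix (I × J) (I × J) ℂ) : EReal :=
  ⨅ (σ : Matrix (I × J) (I × J) ℂ) (_ : IsSeparable σ), maxRelEntropy ρ σ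

/-- Action of a bidirectional map `N_{A'B' → AB}` on an operator of the systems
`(S_A A') : (B' S_B)`, as the identity on `S_A` and `S_B`. -/
def bipartiteAmpliation {SA A' A SB B' B : Type*}
    (N : Matrix (A' × B') (A' × B') ℂ →ₗ[ℂ] Matrix (A × B) (A × B) ℂ)
    (ρ : Matrix ((SA × A') × (B' × SB)) ((SA × A') × (B' × SB)) ℂ) :
    Matrix ((SA × A) × (B × SB)) ((SA × A) × (B × SB)) ℂ :=
  Matrix.of fun p q =>
    N (Matrix.of fun i j => ρ ((p.1.1, i.1), (i.2, p.2.2)) ((q.1.1, j.1), (j.2, q.2.2)))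
      (p.1.2, p.2.1) (q.1.2, q.2.1)

/-- Bidirectional max-relative entropy of entanglement `E_max^{2→2}(N)`: the supremum of
`E_max(S_A A; B S_B)` of `N(ψ_{S_A A'} ⊗ φ_{B' S_B})` over pure states `ψ`, `φ`,
where `S_A ≃ A'` and `S_B ≃ B'`. -/
def bidirectionalMaxRelEntanglement {A' B' A B : Type*}
    [Fintype A'] [Fintype B'] [Fintype A] [Fintype B]
    (N : Matrix (A' × B') (A' × B') ℂ →ₗ[ℂ] Matrix (A × B) (A × B) ℂ) : EReal :=
  ⨆ (ψ : A' × A' → ℂ) (_ : IsUnitVector ψ) (φ : B' × B' → ℂ) (_ : IsUnitVector φ),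
    maxRelEntanglement (bipartiteAmpliation N (ketbra ψ ⊗ₖ ketbra φ))

/-! ### Private reading -/

/-- One use of a wiretap channel `M_{B' → BE}` after `i` earlier uses. The system `E^i` held by the
eavesdropper is extended by the new output `E`; the reader's memory `L` is left alone. -/
def channelUse {B' B E L : Type*} {i : ℕ}
    (M : Matrix B' B' ℂ →ₗ[ℂ] Matrix (B × E) (B × E) ℂ)
    (ρ : Matrix ((Fin i → E) × (L × B')) ((Fin i → E) × (L × B')) ℂ) :
    Matrix ((Fin (i + 1) → E) × (L × B)) ((Fin (i + 1) → E) × (L × B)) ℂ :=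
  Matrix.of fun p q =>
    M (Matrix.of fun y z => ρ (Fin.init p.1, (p.2.1, y)) (Fin.init q.1, (q.2.1, z)))
      (p.2.2, p.1 (Fin.last i)) (q.2.2, q.1 (Fin.last i))

/-- An adaptive decoding strategy with `m + 1` calls and outcomes in `Fin K`: finite-dimensional
memories `L_0, …, L_m`, a transmitter state on `L_0 B'`, interleaved channels
`A^i : L_i B → L_{i+1} B'` for `i < m`, and a measurement on `L_m B`.
(Entries of `mem` beyond `m` and of `adapt` from `m` on play no role.) -/
structure AdaptiveStrategy (B' B : Type*) [Fintype B'] [Fintype B] [DecidableEq B]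
    (m K : ℕ) where
  mem : ℕ → ℕ
  transmitter : Matrix (Fin (mem 0) × B') (Fin (mem 0) × B') ℂ
  transmitter_isDensity : IsDensity transmitter
  adapt : ∀ i : ℕ, Matrix (Fin (mem i) × B) (Fin (mem i) × B) ℂ →ₗ[ℂ]
    Matrix (Fin (mem (i + 1)) × B') (Fin (mem (i + 1)) × B') ℂ
  adapt_isChannel : ∀ i < m, IsChannel (adapt i)
  meas : Fin K → Matrix (Fin (mem m) × B) (Fin (mem m) × B) ℂ
  meas_posSemidef : ∀ k, (meas k).PosSemidef
  meas_sum : ∑ k, meas k = 1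

namespace AdaptiveStrategy

variable {X B' B E : Type*} [Fintype B'] [Fintype B] [DecidableEq B] {m K : ℕ}

/-- The state on `E^i L_i B'` right before call number `i` (counted from `0`) when the memory
device holds the codeword `w`. -/
def inputState (S : AdaptiveStrategy B' B m K)
    (M : X → Matrix B' B' ℂ →ₗ[ℂ] Matrix (B × E) (B × E) ℂ) (w : Fin (m + 1) → X) :
    (i : ℕ) → i ≤ m →
      Matrix ((Fin i → E) × (Fin (S.mem i) × B')) ((Fin i → E) × (Fin (S.mem i) × B')) ℂ
  | 0, _ => Matrix.of fun p q => S.transmitter p.2 q.2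
  | i + 1, h => ampliation (S.adapt i)
      (channelUse (M (w ⟨i, by omega⟩)) (inputState S M w i (by omega)))

/-- The state on `E^n L_m B`, with `n = m + 1`, after all `n` calls. -/
def outputState (S : AdaptiveStrategy B' B m K)
    (M : X → Matrix B' B' ℂ →ₗ[ℂ] Matrix (B × E) (B × E) ℂ) (w : Fin (m + 1) → X) :
    Matrix ((Fin (m + 1) → E) × (Fin (S.mem m) × B))
      ((Fin (m + 1) → E) × (Fin (S.mem m) × B)) ℂ :=
  channelUse (M (w (Fin.last m))) (S.inputState M w m le_rfl)

end AdaptiveStrategy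

/-- An `(m + 1, K, ε, δ)` private reading protocol for the wiretap memory cell
`{M^x_{B' → BE}}_x`: the message `k` is encoded as the codeword `encoder k`. -/
structure PrivateReadingProtocol {X B' B E : Type*} [Fintype B'] [Fintype B] [Fintype E]
    [DecidableEq B] [DecidableEq E]
    (M : X → Matrix B' B' ℂ →ₗ[ℂ] Matrix (B × E) (B × E) ℂ) (m K : ℕ) (ε δ : ℝ) where
  encoder : Fin K → Fin (m + 1) → X
  strategy : AdaptiveStrategy B' B m K
  success : 1 - ε ≤ (1 / K : ℝ) * ∑ k, ((strategy.meas k *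
    traceFst (strategy.outputState M (encoder k))).trace).re
  eveState : Matrix (Fin (m + 1) → E) (Fin (m + 1) → E) ℂ
  eveState_isDensity : IsDensity eveState
  security : (1 / K : ℝ) * ∑ k, (1 / 2 : ℝ) *
    traceNorm (traceSnd (strategy.outputState M (encoder k)) - eveState) ≤ δ

variable {X B' B E : Type*} [Fintype B'] [Fintype B] [Fintype E] [DecidableEq B] [DecidableEq E]

/-- There is an `(n, K, ε, δ)` private reading protocol (`n ≥ 1` calls). -/
def HasProtocol (M : X → Matrix B' B' ℂ →ₗ[ℂ] Matrix (B × E) (B × E) ℂ)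
    (n K : ℕ) (ε δ : ℝ) : Prop :=
  ∃ m : ℕ, n = m + 1 ∧ Nonempty (PrivateReadingProtocol M m K ε δ)

/-- `R` is a strong converse rate: for all errors with `ε + 2δ < 1` and all `δ' > 0`, for
sufficiently large `n` there is no protocol with at least `2^{n(R + δ')}` messages. -/
def IsStrongConverseRate (M : X → Matrix B' B' ℂ →ₗ[ℂ] Matrix (B × E) (B × E) ℂ)
    (R : ℝ) : Prop :=
  ∀ ε δ : ℝ, 0 ≤ ε → 0 ≤ δ → ε + 2 * δ < 1 → ∀ δ' > 0, ∀ᶠ n : ℕ in Filter.atTop,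
    ∀ K : ℕ, (2 : ℝ) ^ ((n : ℝ) * (R + δ')) ≤ (K : ℝ) → ¬ HasProtocol M n K ε δ

/-- The strong converse private reading capacity: the infimum of all strong converse rates. -/
def strongConverseCapacity
    (M : X → Matrix B' B' ℂ →ₗ[ℂ] Matrix (B × E) (B × E) ℂ) : EReal :=
  ⨅ (R : ℝ) (_ : IsStrongConverseRate M R), (R : EReal)

/-! ### The controlled isometry of an isometric wiretap memory cell -/

/-- `∑_x |x⟩⟨x|_X ⊗ U^x_{B' → BE}`. -/
def controlledIsometry {X B' B E : Type*} [Fintype X] [DecidableEq X]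
    (U : X → Matrix (B × E) B' ℂ) : Matrix (X × (B × E)) (X × B') ℂ :=
  ∑ x, Matrix.single x x (1 : ℂ) ⊗ₖ U x

/-- The bidirectional map `N_{XB' → XB}(ρ) = Tr_E {V ρ V†}`, with `V` the controlled isometry. -/
def controlledChannel {X B' B E : Type*} [Fintype X] [DecidableEq X] [Fintype B'] [Fintype E]
    (U : X → Matrix (B × E) B' ℂ) :
    Matrix (X × B') (X × B') ℂ →ₗ[ℂ] Matrix (X × B) (X × B) ℂ where
  toFun ρ := traceSnd (Matrix.reindex (Equiv.prodAssoc X B E).symm (Equiv.prodAssoc X B E).symm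
    (conjChannel (controlledIsometry U) ρ))
  map_add' ρ σ := by
    ext i j
    simp [traceSnd, Finset.sum_add_distrib]
  map_smul' c ρ := by
    ext i j
    simp [traceSnd, Finset.mul_sum]

end PrivateReading

end

/-! Fix a real `t` above the bidirectional quantity. Run a protocol coherently over the message:
attach a register `κ` in the unnormalized superposition `∑_k |k⟩`, purify the transmitter and the
adaptive channels with a reference `R` on the reader's side, and trace out only the eavesdropper's
system `F`. The result is a positive operator on `κ : RZ`. Its size is measured by its pairing with
positive `Y` whose quadratic form is at most `‖u‖²‖w‖²` on product vectors `u ⊗ w`; this is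
`HasBoundedDilation`.

Upper bound. At the start the vector is a product of squared norm `K`, so the size is at most `K`.
Operations on the reader's side are local contractions and do not increase it. If `ρ ≤ 2^s σ` with
`σ` separable, then `Tr Yρ ≤ 2^s`; hence one call of the memory cell multiplies the size by at most
`2^t` (`HasBoundedDilation.channelUse`), whatever entanglement was built up before. After `n` calls
the size is at most `2^{nt} K`.

Lower bound (`HasBoundedDilation.sum_le_sqrt`). For message `k`, apply `√Λ_k` and polar decompose
the result, seen as an operator on `F`. The positive part `P_k` has `Tr P_k²` equal to the success
probability, and `P_k²` lies below the transpose of the eavesdropper's state. By Powers–Størmer,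
secrecy forces `P_k` to overlap with the square root of one fixed state, so the `P_k` add up
constructively: the Hilbert–Schmidt norm of `∑_k P_k` is at least `K(1-ε-δ)`. A single test operator
reads off the square of this norm.

Together, `K²(1-ε-δ)² ≤ 2^{nt} K`, and the constant `(1-ε-δ)²` is invisible at exponential scale. -/

noncomputable section

namespace PrivateReading

open scoped Kronecker ComplexOrder

/-! ### Norms of vectors and contractions -/

/-- The squared Euclidean norm. -/
def normSq {I : Type*} [Fintype I] (z : I → ℂ) : ℝ := ∑ i, ‖z i‖ ^ 2

lemma normSq_nonneg {I : Type*} [Fintype I] (z : I → ℂ) : 0 ≤ normSq z :=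
  Finset.sum_nonneg fun _ _ => by positivity

lemma normSq_smul {I : Type*} [Fintype I] (c : ℂ) (z : I → ℂ) :
    normSq (c • z) = ‖c‖ ^ 2 * normSq z := by
  simp [normSq, mul_pow, Finset.mul_sum]

lemma normSq_prod {I J : Type*} [Fintype I] [Fintype J] (z : I × J → ℂ) :
    normSq z = ∑ i, normSq fun j => z (i, j) := by
  simp [normSq, Fintype.sum_prod_type]

lemma normSq_prod_right {I J : Type*} [Fintype I] [Fintype J] (z : I × J → ℂ) :
    normSq z = ∑ j, normSq fun i => z (i, j) := by
  simp [normSq, Fintype.sum_prod_type_right]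

lemma dotProduct_star_self {I : Type*} [Fintype I] (z : I → ℂ) :
    star z ⬝ᵥ z = (normSq z : ℂ) := by
  simp [dotProduct, normSq, Complex.conj_mul']

lemma normSq_mulVec {I J : Type*} [Fintype I] [Fintype J] (M : Matrix I J ℂ) (z : J → ℂ) :
    (normSq (M.mulVec z) : ℂ) = star z ⬝ᵥ (M.conjTranspose * M).mulVec z := by
  rw [← dotProduct_star_self, Matrix.star_mulVec, ← Matrix.mulVec_mulVec,
    Matrix.dotProduct_mulVec, Matrix.dotProduct_mulVec, Matrix.dotProduct_mulVec]

lemma norm_dotProduct_le {I : Type*} [Fintype I] (a b : I → ℂ) :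
    ‖star a ⬝ᵥ b‖ ≤ √(normSq a) * √(normSq b) := by
  refine (norm_sum_le _ _).trans ?_
  simp only [Pi.star_apply, norm_mul, norm_star]
  exact Real.sum_mul_le_sqrt_mul_sqrt _ _ _

lemma sqrt_normSq_add_le {I : Type*} [Fintype I] (a b : I → ℂ) :
    √(normSq (a + b)) ≤ √(normSq a) + √(normSq b) := by
  simpa [normSq, EuclideanSpace.norm_eq] using norm_add_le (WithLp.toLp 2 a) (WithLp.toLp 2 b)

lemma sqrt_normSq_sum_le {I ι : Type*} [Fintype I] (s : Finset ι) (a : ι → I → ℂ) :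
    √(normSq (∑ k ∈ s, a k)) ≤ ∑ k ∈ s, √(normSq (a k)) := by
  classical
  induction s using Finset.induction_on with
  | empty => simp [normSq]
  | insert k s hk ih =>
    rw [Finset.sum_insert hk, Finset.sum_insert hk]
    exact (sqrt_normSq_add_le _ _).trans (by gcongr)

/-- Matrices that do not increase the Euclidean norm. -/
def IsContraction {I J : Type*} [Fintype I] [Fintype J] (M : Matrix I J ℂ) : Prop :=
  ∀ z, normSq (M.mulVec z) ≤ normSq z

lemma normSq_mulVec_of_isometry {I J : Type*} [Fintype I] [Fintype J] [DecidableEq J]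
    {M : Matrix I J ℂ} (hM : M.conjTranspose * M = 1) (z : J → ℂ) :
    normSq (M.mulVec z) = normSq z := by
  have h := normSq_mulVec M z
  rw [hM, Matrix.one_mulVec, dotProduct_star_self] at h
  exact_mod_cast h

lemma isContraction_of_isometry {I J : Type*} [Fintype I] [Fintype J] [DecidableEq J]
    {M : Matrix I J ℂ} (hM : M.conjTranspose * M = 1) : IsContraction M :=
  fun z => (normSq_mulVec_of_isometry hM z).le

lemma IsContraction.mul {I J L : Type*} [Fintype I] [Fintype J] [Fintype L]
    {M : Matrix I J ℂ} {N : Matrix J L ℂ} (hM : IsContraction M) (hN : IsContraction N) :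
    IsContraction (M * N) := fun z => by
  rw [← Matrix.mulVec_mulVec]
  exact (hM _).trans (hN _)

lemma isContraction_diagonal {I : Type*} [Fintype I] [DecidableEq I] {d : I → ℂ}
    (hd : ∀ i, ‖d i‖ ≤ 1) : IsContraction (Matrix.diagonal d) := fun z => by
  refine Finset.sum_le_sum fun i _ => ?_
  rw [Matrix.mulVec_diagonal, norm_mul, mul_pow]
  exact mul_le_of_le_one_left (by positivity) (pow_le_one₀ (norm_nonneg _) (hd i))

/-- Pythagoras: `‖z‖² = ‖pz‖² + ‖(1-p)z‖²`. -/
lemma isContraction_of_isHermitian_idempotent {I : Type*} [Fintype I] [DecidableEq I]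
    {p : Matrix I I ℂ} (h1 : p.conjTranspose = p) (h2 : p * p = p) : IsContraction p := fun z => by
  have e1 := normSq_mulVec p z
  have e2 := normSq_mulVec (1 - p) z
  have h3 : (1 - p).conjTranspose * (1 - p) = 1 - p := by
    simp [h1, mul_sub, sub_mul, h2]
  rw [h3, Matrix.sub_mulVec, Matrix.one_mulVec, dotProduct_sub, dotProduct_star_self] at e2
  rw [h1, h2] at e1
  rw [← e1] at e2
  have e3 : normSq ((1 - p).mulVec z) = normSq z - normSq (p.mulVec z) := by
    apply Complex.ofReal_injective
    simpa [Matrix.sub_mulVec] using e2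
  linarith [normSq_nonneg ((1 - p).mulVec z)]

/-- The hypothesis makes `M` a partial isometry: `‖Mz‖ = ‖pz‖` for the projection `p = M†M`. -/
lemma IsContraction.of_conjTranspose_mul_self {I J : Type*} [Fintype I] [Fintype J]
    [DecidableEq J] {M : Matrix I J ℂ}
    (h : M.conjTranspose * M * (M.conjTranspose * M) = M.conjTranspose * M) :
    IsContraction M := fun z => by
  have hp := isContraction_of_isHermitian_idempotent (p := M.conjTranspose * M) (by simp) h z
  have e1 := normSq_mulVec M z
  have e2 := normSq_mulVec (M.conjTranspose * M) z
  simp only [Matrix.conjTranspose_mul, Matrix.conjTranspose_conjTranspose] at e2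
  rw [h, ← e1] at e2
  have : normSq ((M.conjTranspose * M).mulVec z) = normSq (M.mulVec z) := by exact_mod_cast e2
  linarith

/-! ### Spectral decomposition -/

lemma exists_diagonalization {I : Type*} [Fintype I] [DecidableEq I] {A : Matrix I I ℂ}
    (hA : A.IsHermitian) : ∃ V : Matrix I I ℂ, V.conjTranspose * V = 1 ∧ V * V.conjTranspose = 1 ∧
      A = V * Matrix.diagonal (fun i => (hA.eigenvalues i : ℂ)) * V.conjTranspose :=
  ⟨hA.eigenvectorUnitary, Unitary.coe_star_mul_self _, Unitary.coe_mul_star_self _, by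
    conv_lhs => rw [hA.spectral_theorem, Unitary.conjStarAlgAut_apply]
    rfl⟩

lemma conj_diagonal_mul {I : Type*} [Fintype I] [DecidableEq I] {V : Matrix I I ℂ}
    (hV : V.conjTranspose * V = 1) (a b : I → ℂ) :
    V * Matrix.diagonal a * V.conjTranspose * (V * Matrix.diagonal b * V.conjTranspose) =
      V * Matrix.diagonal (fun i => a i * b i) * V.conjTranspose := by
  rw [← Matrix.diagonal_mul_diagonal]
  calc _ = V * Matrix.diagonal a * (V.conjTranspose * V) * Matrix.diagonal b * V.conjTranspose := by
        simp only [Matrix.mul_assoc]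
    _ = _ := by rw [hV]; simp only [Matrix.mul_assoc, Matrix.one_mul]

lemma conjTranspose_conj_diagonal {I : Type*} [Fintype I] [DecidableEq I] (V : Matrix I I ℂ)
    (a : I → ℝ) : (V * Matrix.diagonal (fun i => (a i : ℂ)) * V.conjTranspose).conjTranspose =
      V * Matrix.diagonal (fun i => (a i : ℂ)) * V.conjTranspose := by
  simp only [Matrix.conjTranspose_mul, Matrix.conjTranspose_conjTranspose,
    Matrix.diagonal_conjTranspose, Matrix.mul_assoc]
  congr 3
  ext i
  simp

/-- Polar decomposition `M = W P` with `P ≥ 0` and a partial isometry `W` such that `W† M = P`. -/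
lemma exists_polar {I J : Type*} [Fintype I] [Fintype J] (M : Matrix I J ℂ) :
    ∃ (W : Matrix I J ℂ) (P : Matrix J J ℂ), P.PosSemidef ∧ P * P = M.conjTranspose * M ∧
      M = W * P ∧ W.conjTranspose * M = P ∧ IsContraction W ∧ IsContraction W.conjTranspose := by
  classical
  have hA := Matrix.isHermitian_conjTranspose_mul_self M
  have hpos := (Matrix.posSemidef_conjTranspose_mul_self M).eigenvalues_nonneg
  obtain ⟨V, hV, hV', hMM⟩ := exists_diagonalization hA
  set l := hA.eigenvalues with hl
  let f : (I : J → ℝ) → Matrix J J ℂ :=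
    fun a => V * Matrix.diagonal (fun i => (a i : ℂ)) * V.conjTranspose
  have fmul : ∀ a b, f a * f b = f (fun i => a i * b i) := fun a b => by
    simp only [f, conj_diagonal_mul hV, Complex.ofReal_mul]
  have fH : ∀ a, (f a).conjTranspose = f a := fun a => conjTranspose_conj_diagonal V a
  have hM : M.conjTranspose * M = f l := hMM
  set P := f fun i => √(l i) with hP
  -- Since `0⁻¹ = 0`, `Q` is the pseudo-inverse of `P` and `p = QP` is the projection onto the
  -- support of `P`. The partial isometry is `W = MQ`.
  set Q := f fun i => (√(l i))⁻¹ with hQ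
  set p := f fun i => (√(l i))⁻¹ * √(l i) with hp
  have hQP : Q * P = p := fmul _ _
  have hPQ : P * Q = p := by rw [hp, fmul]; congr 1; ext i; ring
  have hPP : P * P = M.conjTranspose * M := by
    rw [hM, fmul]; congr 1; ext i; exact Real.mul_self_sqrt (hpos i)
  have hpp : p * p = p := by
    rw [hp, fmul]; congr 1; ext i
    by_cases h : √(l i) = 0
    · simp [h]
    · field_simp
  have hpP : p * P = P := by
    rw [hp, hP, fmul]; congr 1; ext i
    by_cases h : √(l i) = 0
    · simp [h]
    · field_simp
  have hPp : P * p = P := by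
    rw [hp, hP, fmul]; congr 1; ext i
    by_cases h : √(l i) = 0
    · simp [h]
    · field_simp
  have hMp : M * p = M := by
    have : (M * (1 - p)).conjTranspose * (M * (1 - p)) = 0 := by
      rw [Matrix.conjTranspose_mul, Matrix.mul_assoc, ← Matrix.mul_assoc M.conjTranspose, ← hPP,
        Matrix.mul_assoc, mul_sub, hPp]
      simp
    rw [Matrix.conjTranspose_mul_self_eq_zero, Matrix.mul_sub, Matrix.mul_one, sub_eq_zero] at this
    exact this.symm
  have hWW : (M * Q).conjTranspose * (M * Q) = p := by
    rw [Matrix.conjTranspose_mul, fH, Matrix.mul_assoc Q, ← Matrix.mul_assoc M.conjTranspose,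
      ← hPP, Matrix.mul_assoc P, hPQ, hPp, hQP]
  refine ⟨M * Q, P, ?_, hPP, ?_, ?_, ?_, ?_⟩
  · exact (Matrix.PosSemidef.diagonal (fun i => by simp)).mul_mul_conjTranspose_same V
  · rw [Matrix.mul_assoc, hQP, hMp]
  · rw [Matrix.conjTranspose_mul, fH, Matrix.mul_assoc, ← hPP, ← Matrix.mul_assoc, hQP, hpP]
  · exact .of_conjTranspose_mul_self (by rw [hWW, hpp])
  · refine .of_conjTranspose_mul_self ?_
    rw [Matrix.conjTranspose_conjTranspose, Matrix.mul_assoc,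
      ← Matrix.mul_assoc _ (M * Q), hWW, Matrix.conjTranspose_mul, fH, ← Matrix.mul_assoc p]
    congr 2
    refine (fmul _ _).trans (congrArg f (funext fun i => ?_))
    by_cases h : √(l i) = 0
    · simp [h]
    · field_simp

lemma trace_mul_ketbra {I : Type*} [Fintype I] (Y : Matrix I I ℂ) (z : I → ℂ) :
    (Y * ketbra z).trace = star z ⬝ᵥ Y.mulVec z := by
  rw [ketbra, Matrix.mul_vecMulVec, Matrix.trace_vecMulVec, dotProduct_comm]

lemma exists_eq_sum_ketbra {I : Type*} [Fintype I] {ρ : Matrix I I ℂ} (h : ρ.PosSemidef) :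
    ∃ (m : ℕ) (v : Fin m → I → ℂ), ρ = ∑ i, ketbra (v i) :=
  Matrix.posSemidef_iff_eq_sum_vecMulVec.mp h

lemma trace_ketbra {I : Type*} [Fintype I] (z : I → ℂ) :
    (ketbra z).trace = (normSq z : ℂ) := by
  rw [ketbra, Matrix.trace_vecMulVec, dotProduct_comm, dotProduct_star_self]

lemma re_trace_mul_nonneg {I : Type*} [Fintype I] {Y ρ : Matrix I I ℂ} (hY : Y.PosSemidef)
    (hρ : ρ.PosSemidef) : 0 ≤ (Y * ρ).trace.re := by
  obtain ⟨m, v, rfl⟩ := exists_eq_sum_ketbra hρ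
  rw [Matrix.mul_sum, Matrix.trace_sum, Complex.re_sum]
  refine Finset.sum_nonneg fun i _ => ?_
  rw [trace_mul_ketbra]
  exact (Complex.le_def.mp (hY.dotProduct_mulVec_nonneg (v i))).1

lemma IsContraction.re_trace_mul_le {I : Type*} [Fintype I] {G ρ : Matrix I I ℂ}
    (hG : IsContraction G) (hρ : ρ.PosSemidef) : (G * ρ).trace.re ≤ ρ.trace.re := by
  obtain ⟨m, v, rfl⟩ := exists_eq_sum_ketbra hρ
  rw [Matrix.mul_sum, Matrix.trace_sum, Matrix.trace_sum, Complex.re_sum, Complex.re_sum]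
  refine Finset.sum_le_sum fun i _ => ?_
  rw [trace_mul_ketbra, trace_ketbra, Complex.ofReal_re]
  refine (Complex.re_le_norm _).trans ((norm_dotProduct_le _ _).trans ?_)
  refine (mul_le_mul_of_nonneg_left (Real.sqrt_le_sqrt (hG (v i))) (Real.sqrt_nonneg _)).trans ?_
  rw [Real.mul_self_sqrt (normSq_nonneg _)]

/-! ### The trace norm and the Powers–Størmer inequality -/

/-- Expand the trace in an orthonormal basis `v_i` of right singular vectors: `‖M v_i‖` is the
`i`-th singular value, and Cauchy–Schwarz bounds each term. -/
lemma IsContraction.re_trace_mul_le_traceNorm {I : Type*} [Fintype I] [DecidableEq I]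
    {G : Matrix I I ℂ} (hG : IsContraction G) (M : Matrix I I ℂ) :
    (G * M).trace.re ≤ traceNorm M := by
  have hA := Matrix.isHermitian_conjTranspose_mul_self M
  obtain ⟨V, hV, hV', hMM⟩ := exists_diagonalization hA
  have e1 : (G * M).trace = ∑ i, star (V.col i) ⬝ᵥ G.mulVec (M.mulVec (V.col i)) := by
    have : (G * M).trace = (V.conjTranspose * (G * (M * V))).trace := by
      rw [Matrix.trace_mul_comm V.conjTranspose, Matrix.mul_assoc G, Matrix.mul_assoc M, hV',
        Matrix.mul_one]
    rw [this]
    rfl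
  have e2 : ∀ i, normSq (M.mulVec (V.col i)) = hA.eigenvalues i := fun i => by
    have h3 : V.conjTranspose * (M.conjTranspose * M * V) =
        Matrix.diagonal (fun i => (hA.eigenvalues i : ℂ)) := by
      conv_lhs => rw [hMM]
      rw [Matrix.mul_assoc _ V.conjTranspose, hV, Matrix.mul_one, ← Matrix.mul_assoc, hV,
        Matrix.one_mul]
    have h4 := congrFun (congrFun h3 i) i
    rw [Matrix.diagonal_apply_eq] at h4
    have h5 := normSq_mulVec M (V.col i)
    have h6 : (normSq (M.mulVec (V.col i)) : ℂ) = hA.eigenvalues i := h5.trans h4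
    exact_mod_cast h6
  have e3 : ∀ i, normSq (V.col i) = 1 := fun i => by
    have h4 := congrFun (congrFun hV i) i
    rw [Matrix.one_apply_eq] at h4
    have h6 : (normSq (V.col i) : ℂ) = 1 := (dotProduct_star_self _).symm.trans h4
    exact_mod_cast h6
  rw [e1, Complex.re_sum]
  refine Finset.sum_le_sum fun i _ => ?_
  refine (Complex.re_le_norm _).trans ((norm_dotProduct_le _ _).trans ?_)
  rw [e3, Real.sqrt_one, one_mul]
  exact Real.sqrt_le_sqrt ((hG _).trans_eq (e2 i))

/-- The Powers–Størmer inequality, in variational form. -/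
lemma exists_isContraction_re_trace_sub_mul_sub_le {I : Type*} [Fintype I] {A B : Matrix I I ℂ}
    (hA : A.PosSemidef) (hB : B.PosSemidef) : ∃ G : Matrix I I ℂ, IsContraction G ∧
      G.IsHermitian ∧ ((A - B) * (A - B)).trace.re ≤ (G * (A * A - B * B)).trace.re := by
  classical
  have hS : (A - B).IsHermitian := hA.isHermitian.sub hB.isHermitian
  obtain ⟨V, hV, hV', hVS⟩ := exists_diagonalization hS
  set l := hS.eigenvalues
  -- `G` is the sign of `A - B`, so that `G(A - B) = |A - B|`.
  let sg : I → ℂ := fun i => ((SignType.sign (l i) : ℝ) : ℂ)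
  let G := V * Matrix.diagonal sg * V.conjTranspose
  have hsg : ∀ i, sg i * l i = (|l i| : ℝ) := fun i => by
    simp only [sg, ← Complex.ofReal_mul, sign_mul_self]
  have hGS : G * (A - B) = V * Matrix.diagonal (fun i => ((|l i| : ℝ) : ℂ)) * V.conjTranspose := by
    rw [hVS, conj_diagonal_mul hV]
    simp only [hsg]
  have hSG : (A - B) * G = V * Matrix.diagonal (fun i => ((|l i| : ℝ) : ℂ)) * V.conjTranspose := by
    rw [hVS, conj_diagonal_mul hV]
    simp only [mul_comm _ (sg _), hsg]
  have cyc : ∀ (d : I → ℂ) (Z : Matrix I I ℂ),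
      (V * Matrix.diagonal d * V.conjTranspose * Z).trace =
        ∑ i, d i * (V.conjTranspose * Z * V) i i := fun d Z => by
    rw [Matrix.mul_assoc, Matrix.mul_assoc, Matrix.trace_mul_comm, Matrix.mul_assoc]
    simp [Matrix.trace, Matrix.diagonal_mul]
  have hdA := fun i => (hA.conjTranspose_mul_mul_same V).diag_nonneg (i := i)
  have hdB := fun i => (hB.conjTranspose_mul_mul_same V).diag_nonneg (i := i)
  have hdS : ∀ i, (V.conjTranspose * A * V) i i - (V.conjTranspose * B * V) i i = l i := fun i => by
    have : V.conjTranspose * A * V - V.conjTranspose * B * V =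
        Matrix.diagonal (fun i => (l i : ℂ)) := by
      rw [← sub_mul, ← mul_sub, hVS, Matrix.mul_assoc, Matrix.mul_assoc, hV, Matrix.mul_one,
        ← Matrix.mul_assoc, hV, Matrix.one_mul]
    simpa using congrFun (congrFun this i) i
  have hG : IsContraction G := by
    refine ((isContraction_of_isometry hV).mul (isContraction_diagonal fun i => ?_)).mul
      (isContraction_of_isometry (by simpa using hV'))
    simp only [sg, Complex.norm_real]
    rcases lt_trichotomy (l i) 0 with h | h | h <;> simp [h]
  refine ⟨G, hG, conjTranspose_conj_diagonal V _, ?_⟩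
  have e1 : ((A - B) * (A - B)).trace = ∑ i, ((l i * l i : ℝ) : ℂ) := by
    conv_lhs => rw [hVS, conj_diagonal_mul hV, Matrix.trace_mul_comm, ← Matrix.mul_assoc, hV,
      Matrix.one_mul]
    simp [Matrix.trace]
  have e2 : (G * (A * A - B * B)).trace =
      ∑ i, ((|l i| : ℝ) : ℂ) * (V.conjTranspose * (A + B) * V) i i := by
    rw [← cyc]
    -- Half the anticommutator of `A - B` and `A + B` is `A² - B²`. As `G` commutes with `A - B`,
    -- both halves have the same trace against `G`, namely `Tr |A - B|(A + B)`.
    have h2 : (2 : ℂ) • (A * A - B * B) = (A - B) * (A + B) + (A + B) * (A - B) := by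
      rw [two_smul]; noncomm_ring
    have h3 : (2 : ℂ) * (G * (A * A - B * B)).trace = 2 * (G * (A - B) * (A + B)).trace := by
      rw [← smul_eq_mul, ← Matrix.trace_smul, ← Matrix.mul_smul, h2, mul_add, Matrix.trace_add,
        two_mul]
      congr 1
      · rw [← Matrix.mul_assoc G]
      · rw [Matrix.trace_mul_comm G, Matrix.mul_assoc, hSG, ← hGS, Matrix.trace_mul_comm]
    rw [← hGS]
    exact mul_left_cancel₀ two_ne_zero h3
  rw [e1, e2, Complex.re_sum, Complex.re_sum]
  -- With `a, b ≥ 0` the diagonal entries of `A` and `B` in the eigenbasis of `A - B`, the claim is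
  -- `|a - b|² ≤ |a - b|(a + b)`.
  refine Finset.sum_le_sum fun i _ => ?_
  rw [Complex.ofReal_re, Complex.re_ofReal_mul, ← abs_mul_abs_self]
  refine mul_le_mul_of_nonneg_left ?_ (abs_nonneg _)
  have h1 := (Complex.le_def.mp (hdA i)).1
  have h2 := (Complex.le_def.mp (hdB i)).1
  have h3 := congrArg Complex.re (hdS i)
  rw [mul_add, add_mul, Matrix.add_apply]
  simp only [Complex.zero_re, Complex.sub_re, Complex.ofReal_re, Complex.add_re] at *
  rw [abs_le]
  constructor <;> linarith

/-! ### Quadratic forms that are bounded on product vectors -/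

/-- The real quadratic form `⟨z|Y|z⟩`. -/
def quad {I : Type*} [Fintype I] (Y : Matrix I I ℂ) (z : I → ℂ) : ℝ := (star z ⬝ᵥ Y.mulVec z).re

lemma quad_conj {I J : Type*} [Fintype I] [Fintype J] (Y : Matrix I I ℂ) (M : Matrix I J ℂ)
    (z : J → ℂ) : quad (M.conjTranspose * Y * M) z = quad Y (M.mulVec z) := by
  rw [quad, quad, Matrix.star_mulVec, ← Matrix.mulVec_mulVec, ← Matrix.mulVec_mulVec,
    Matrix.dotProduct_mulVec (star z) M.conjTranspose]

lemma quad_sum {I ι : Type*} [Fintype I] (s : Finset ι) (Y : ι → Matrix I I ℂ) (z : I → ℂ) :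
    quad (∑ k ∈ s, Y k) z = ∑ k ∈ s, quad (Y k) z := by
  simp only [quad, Matrix.sum_mulVec, dotProduct_sum, Complex.re_sum]

lemma quad_smul_left {I : Type*} [Fintype I] (c : ℝ) (Y : Matrix I I ℂ) (z : I → ℂ) :
    quad (c • Y) z = c * quad Y z := by
  simp only [quad, Matrix.smul_mulVec, dotProduct_smul, Complex.smul_re, smul_eq_mul]

lemma quad_smul_right {I : Type*} [Fintype I] (Y : Matrix I I ℂ) (c : ℂ) (z : I → ℂ) :
    quad Y (c • z) = ‖c‖ ^ 2 * quad Y z := by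
  simp only [quad, Matrix.mulVec_smul, star_smul, smul_dotProduct, dotProduct_smul, smul_eq_mul]
  rw [← mul_assoc, Complex.star_def, Complex.mul_conj', ← Complex.ofReal_pow,
    Complex.re_ofReal_mul]

lemma quad_conjTranspose_mul_self {I J : Type*} [Fintype I] [Fintype J] (T : Matrix I J ℂ)
    (z : J → ℂ) : quad (T.conjTranspose * T) z = normSq (T.mulVec z) := by
  rw [quad, ← normSq_mulVec, Complex.ofReal_re]

lemma re_trace_mul_ketbra {I : Type*} [Fintype I] (Y : Matrix I I ℂ) (z : I → ℂ) :
    (Y * ketbra z).trace.re = quad Y z := by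
  rw [trace_mul_ketbra, quad]

/-- The product vector `u ⊗ w`. -/
def tensorVec {I J : Type*} (u : I → ℂ) (w : J → ℂ) : I × J → ℂ := fun p => u p.1 * w p.2

lemma ketbra_kronecker_ketbra {I J : Type*} (u : I → ℂ) (w : J → ℂ) :
    ketbra u ⊗ₖ ketbra w = ketbra (tensorVec u w) := by
  ext p q
  simp only [ketbra, tensorVec, Matrix.kroneckerMap_apply, Matrix.vecMulVec_apply, Pi.star_apply,
    star_mul']
  ring

lemma kronecker_mulVec_tensorVec {I J I' J' : Type*} [Fintype I] [Fintype J]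
    (G : Matrix I' I ℂ) (H : Matrix J' J ℂ) (u : I → ℂ) (w : J → ℂ) :
    (G ⊗ₖ H).mulVec (tensorVec u w) = tensorVec (G.mulVec u) (H.mulVec w) := by
  ext p
  simp only [Matrix.mulVec, dotProduct, tensorVec, Matrix.kroneckerMap_apply,
    Fintype.sum_prod_type, Finset.sum_mul_sum]
  exact Finset.sum_congr rfl fun i _ => Finset.sum_congr rfl fun j _ => by ring

lemma exists_eq_smul_normSq_eq_one {I : Type*} [Fintype I] (z : I → ℂ) :
    ∃ (a : ℂ) (z' : I → ℂ), z = a • z' ∧ (normSq z' = 1 ∨ a = 0) := by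
  by_cases hz : normSq z = 0
  · refine ⟨0, 0, ?_, Or.inr rfl⟩
    ext i
    have := (Finset.sum_eq_zero_iff_of_nonneg (fun _ _ => by positivity)).mp hz i
      (Finset.mem_univ i)
    simpa using this
  · have hpos : 0 < normSq z := lt_of_le_of_ne (normSq_nonneg z) (Ne.symm hz)
    have hs : (√(normSq z) : ℂ) ≠ 0 := by
      exact_mod_cast (Real.sqrt_pos.mpr hpos).ne'
    refine ⟨√(normSq z), (√(normSq z) : ℂ)⁻¹ • z, ?_, Or.inl ?_⟩
    · rw [smul_smul, mul_inv_cancel₀ hs, one_smul]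
    · rw [normSq_smul, norm_inv, Complex.norm_real, inv_pow, Real.norm_eq_abs, sq_abs,
        Real.sq_sqrt hpos.le, inv_mul_cancel₀ hz]

/-- The quadratic form of `Y` is at most one on normalized product vectors. -/
def ProdBounded {I J : Type*} [Fintype I] [Fintype J] (Y : Matrix (I × J) (I × J) ℂ) : Prop :=
  ∀ u w, quad Y (tensorVec u w) ≤ normSq u * normSq w

lemma ProdBounded.conj {I J I' J' : Type*} [Fintype I] [Fintype J] [Fintype I'] [Fintype J']
    {Y : Matrix (I' × J') (I' × J') ℂ} (hY : ProdBounded Y) {G : Matrix I' I ℂ}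
    {H : Matrix J' J ℂ} (hG : IsContraction G) (hH : IsContraction H) :
    ProdBounded ((G ⊗ₖ H).conjTranspose * Y * (G ⊗ₖ H)) := fun u w => by
  rw [quad_conj, kronecker_mulVec_tensorVec]
  exact (hY _ _).trans (mul_le_mul (hG u) (hH w) (normSq_nonneg _) (normSq_nonneg _))

lemma ProdBounded.re_trace_mul_kronecker_le {I J : Type*} [Fintype I] [Fintype J]
    {Y : Matrix (I × J) (I × J) ℂ} (hY : ProdBounded Y) {ω : Matrix I I ℂ} {τ : Matrix J J ℂ}
    (hω : IsDensity ω) (hτ : IsDensity τ) : (Y * (ω ⊗ₖ τ)).trace.re ≤ 1 := by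
  obtain ⟨⟨m, a, rfl⟩, h1⟩ := hω.imp_left exists_eq_sum_ketbra
  obtain ⟨⟨n, b, rfl⟩, h2⟩ := hτ.imp_left exists_eq_sum_ketbra
  simp only [Matrix.trace_sum, trace_ketbra] at h1 h2
  have h1' : ∑ i, normSq (a i) = 1 := by exact_mod_cast h1
  have h2' : ∑ i, normSq (b i) = 1 := by exact_mod_cast h2
  have : (∑ i, ketbra (a i)) ⊗ₖ (∑ j, ketbra (b j)) =
      ∑ i, ∑ j, ketbra (tensorVec (a i) (b j)) := by
    simp only [← ketbra_kronecker_ketbra]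
    ext p q
    simp only [Matrix.kroneckerMap_apply, Matrix.sum_apply, Finset.sum_mul_sum]
  rw [this]
  simp only [Matrix.mul_sum, Matrix.trace_sum, Complex.re_sum, re_trace_mul_ketbra]
  calc _ ≤ ∑ i, ∑ j, normSq (a i) * normSq (b j) :=
        Finset.sum_le_sum fun i _ => Finset.sum_le_sum fun j _ => hY _ _
    _ = 1 := by rw [← Finset.sum_mul_sum, h1', h2', one_mul]

lemma ProdBounded.re_trace_mul_le {I J : Type*} [Fintype I] [Fintype J]
    {Y σ : Matrix (I × J) (I × J) ℂ} (hY : ProdBounded Y) (hσ : IsSeparable σ) :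
    (Y * σ).trace.re ≤ 1 := by
  obtain ⟨m, p, ω, τ, hp, hsum, hω, hτ, rfl⟩ := hσ
  simp only [Matrix.mul_sum, Matrix.trace_sum, Complex.re_sum, Matrix.mul_smul, Matrix.trace_smul,
    Complex.smul_re, smul_eq_mul]
  rw [← hsum]
  exact Finset.sum_le_sum fun x _ =>
    mul_le_of_le_one_right (hp x) (hY.re_trace_mul_kronecker_le (hω x) (hτ x))

/-- Duality: a bound on `E_max` controls all positive operators bounded on product vectors. -/
lemma ProdBounded.re_trace_mul_le_rpow {I J : Type*} [Fintype I] [Fintype J]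
    {Y ρ : Matrix (I × J) (I × J) ℂ} (hY : ProdBounded Y) (hY0 : Y.PosSemidef) {R : ℝ}
    (hR : maxRelEntanglement ρ < R) : (Y * ρ).trace.re ≤ 2 ^ R := by
  simp only [maxRelEntanglement, maxRelEntropy, iInf_lt_iff] at hR
  obtain ⟨σ, hσ, t, ht, htR⟩ := hR
  have h := re_trace_mul_nonneg hY0 ht
  rw [mul_sub, Matrix.trace_sub, Complex.sub_re, Matrix.mul_smul, Matrix.trace_smul,
    Complex.smul_re, smul_eq_mul] at h
  have h1 := hY.re_trace_mul_le hσ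
  have h2 : (2 : ℝ) ^ t ≤ 2 ^ R :=
    Real.rpow_le_rpow_of_exponent_le one_le_two (EReal.coe_le_coe_iff.mp htR.le)
  have h3 : (0 : ℝ) < 2 ^ t := by positivity
  nlinarith

/-! ### One use of the controlled channel -/

section Controlled

variable {X B' B E : Type*} [Fintype X] [DecidableEq X] [Fintype B'] [Fintype E]

/-- The component at `e` of the vector obtained from `ψ ⊗ φ` by the controlled isometry. -/
def controlledOutput (U : X → Matrix (B × E) B' ℂ) (ψ : X × X → ℂ) (φ : B' × B' → ℂ) (e : E) :
    (X × X) × (B × B') → ℂ :=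
  fun p => ∑ b', U p.1.2 (p.2.1, e) b' * (ψ p.1 * φ (b', p.2.2))

lemma controlledChannel_apply (U : X → Matrix (B × E) B' ℂ)
    (ρ : Matrix (X × B') (X × B') ℂ) (p q : X × B) :
    controlledChannel U ρ p q = ∑ e, ∑ c, ∑ b', U p.1 (p.2, e) b' * ρ (p.1, b') (q.1, c) *
      star (U q.1 (q.2, e) c) := by
  have hU : ∀ (x y : X) (r : B × E) (b' : B'),
      controlledIsometry U (x, r) (y, b') = if x = y then U x r b' else 0 := fun x y r b' => by
    simp [controlledIsometry, Matrix.sum_apply, Matrix.single_apply, ite_and]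
  simp [controlledChannel, traceSnd, conjChannel, Matrix.mul_apply, hU, Fintype.sum_prod_type,
    Finset.sum_mul, apply_ite]

lemma bipartiteAmpliation_controlledChannel (U : X → Matrix (B × E) B' ℂ) (ψ : X × X → ℂ)
    (φ : B' × B' → ℂ) : bipartiteAmpliation (controlledChannel U) (ketbra ψ ⊗ₖ ketbra φ) =
      ∑ e, ketbra (controlledOutput U ψ φ e) := by
  ext p q
  simp only [bipartiteAmpliation, Matrix.of_apply, controlledChannel_apply, Matrix.sum_apply]
  refine Finset.sum_congr rfl fun e _ => ?_
  simp only [ketbra, Matrix.vecMulVec_apply, controlledOutput, Matrix.kroneckerMap_apply,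
    Pi.star_apply, star_sum, star_mul']
  rw [Finset.sum_mul_sum, Finset.sum_comm]
  exact Finset.sum_congr rfl fun b _ => Finset.sum_congr rfl fun c _ => by ring

/-- Unit vectors are covered by duality and the definition of the supremum; both sides are
homogeneous in `ψ` and `φ`, which gives the rest. -/
lemma ProdBounded.sum_quad_controlledOutput_le [Fintype B] {U : X → Matrix (B × E) B' ℂ} {R : ℝ}
    (hR : bidirectionalMaxRelEntanglement (controlledChannel U) < R)
    {Y : Matrix ((X × X) × (B × B')) ((X × X) × (B × B')) ℂ} (hY : ProdBounded Y)
    (hY0 : Y.PosSemidef) (ψ : X × X → ℂ) (φ : B' × B' → ℂ) :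
    ∑ e, quad Y (controlledOutput U ψ φ e) ≤ 2 ^ R * (normSq ψ * normSq φ) := by
  have unit : ∀ ψ φ, normSq ψ = 1 → normSq φ = 1 →
      ∑ e, quad Y (controlledOutput U ψ φ e) ≤ 2 ^ R := fun ψ φ hψ hφ => by
    have h1 : maxRelEntanglement (bipartiteAmpliation (controlledChannel U)
        (ketbra ψ ⊗ₖ ketbra φ)) < R :=
      lt_of_le_of_lt (le_iSup₂_of_le (f := fun ψ (_ : IsUnitVector ψ) =>
        ⨆ (φ : B' × B' → ℂ) (_ : IsUnitVector φ), maxRelEntanglement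
          (bipartiteAmpliation (controlledChannel U) (ketbra ψ ⊗ₖ ketbra φ))) ψ hψ
        (le_iSup₂_of_le (f := fun φ (_ : IsUnitVector φ) => maxRelEntanglement
          (bipartiteAmpliation (controlledChannel U) (ketbra ψ ⊗ₖ ketbra φ))) φ hφ le_rfl)) hR
    rw [bipartiteAmpliation_controlledChannel] at h1
    have h2 := hY.re_trace_mul_le_rpow hY0 h1
    simpa only [Matrix.mul_sum, Matrix.trace_sum, Complex.re_sum, re_trace_mul_ketbra] using h2
  have scale : ∀ (a b : ℂ) (ψ : X × X → ℂ) (φ : B' × B' → ℂ) (e : E),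
      controlledOutput U (a • ψ) (b • φ) e = (a * b) • controlledOutput U ψ φ e :=
    fun a b ψ φ e => by
      ext p
      simp only [controlledOutput, Pi.smul_apply, smul_eq_mul, Finset.mul_sum]
      exact Finset.sum_congr rfl fun _ _ => by ring
  obtain ⟨a, ψ, rfl, ha⟩ := exists_eq_smul_normSq_eq_one ψ
  obtain ⟨b, φ, rfl, hb⟩ := exists_eq_smul_normSq_eq_one φ
  simp only [scale, quad_smul_right, ← Finset.mul_sum, normSq_smul, norm_mul]
  rcases ha with ha | rfl
  · rcases hb with hb | rfl
    · rw [ha, hb]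
      have := mul_le_mul_of_nonneg_left (unit ψ φ ha hb) (sq_nonneg (‖a‖ * ‖b‖))
      linarith
    · simp
  · simp

end Controlled

/-! ### Kraus operators -/

lemma conj_vecMulVec {I O : Type*} [Fintype I] (V : Matrix O I ℂ) (y z : I → ℂ) :
    V * Matrix.vecMulVec y (star z) * V.conjTranspose =
      Matrix.vecMulVec (V.mulVec y) (star (V.mulVec z)) := by
  rw [Matrix.mul_vecMulVec, Matrix.vecMulVec_mul, Matrix.star_mulVec]

lemma conj_ketbra {I O : Type*} [Fintype I] (V : Matrix O I ℂ) (z : I → ℂ) :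
    V * ketbra z * V.conjTranspose = ketbra (V.mulVec z) := conj_vecMulVec V z z

/-- Choi's argument: the rank-one terms of the positive operator obtained from an unnormalized
maximally entangled vector, reshaped into matrices, are the Kraus operators. -/
lemma IsChannel.exists_kraus {I O : Type*} [Fintype I] [Fintype O]
    {Φ : Matrix I I ℂ →ₗ[ℂ] Matrix O O ℂ} (hΦ : IsChannel Φ) :
    ∃ (r : ℕ) (A : Fin r → Matrix O I ℂ),
      (∀ ρ, Φ ρ = ∑ s, A s * ρ * (A s).conjTranspose) ∧
      ∀ z, ∑ s, normSq ((A s).mulVec z) = normSq z := by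
  classical
  let e := (Fintype.equivFin I).symm
  let ω : Fin (Fintype.card I) × I → ℂ := fun p => if e p.1 = p.2 then 1 else 0
  have hω : (ketbra ω).PosSemidef := Matrix.posSemidef_vecMulVec_self_star ω
  obtain ⟨r, v, hv⟩ := exists_eq_sum_ketbra (hΦ.completelyPositive _ _ hω)
  let A : Fin r → Matrix O I ℂ := fun s => Matrix.of fun o i => v s (e.symm i, o)
  have hsingle : ∀ (i j : I), Φ (Matrix.single i j (1 : ℂ)) =
      ∑ s, A s * Matrix.single i j (1 : ℂ) * (A s).conjTranspose := fun i j => by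
    ext o o'
    have h := congrFun (congrFun hv (e.symm i, o)) (e.symm j, o')
    have h2 : (Matrix.of fun i' j' => ketbra ω (e.symm i, i') (e.symm j, j')) =
        Matrix.single i j (1 : ℂ) := by
      ext i' j'
      by_cases h1 : i = i' <;> by_cases h2 : j = j' <;>
        simp [ketbra, ω, Matrix.vecMulVec_apply, h1, h2]
    simp only [ampliation, Matrix.of_apply] at h
    rw [h2] at h
    rw [h, Matrix.sum_apply, Matrix.sum_apply]
    refine Finset.sum_congr rfl fun s _ => ?_
    rw [Matrix.mul_apply, Finset.sum_eq_single j]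
    · simp [ketbra, Matrix.vecMulVec_apply, A]
    · intro b _ hb
      simp [Matrix.mul_single_apply_of_ne, hb]
    · simp
  have hK : ∀ ρ, Φ ρ = ∑ s, A s * ρ * (A s).conjTranspose := fun ρ => by
    have hρ : ρ = ∑ i, ∑ j, ρ i j • Matrix.single i j (1 : ℂ) := by
      conv_lhs => rw [Matrix.matrix_eq_sum_single ρ]
      simp [Matrix.smul_single]
    rw [hρ]
    simp only [map_sum, map_smul, hsingle, Matrix.mul_sum, Matrix.sum_mul, Finset.smul_sum,
      Matrix.mul_smul, Matrix.smul_mul]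
    rw [Finset.sum_comm]
    conv_rhs => rw [Finset.sum_comm]
    rw [Finset.sum_comm]
    refine Finset.sum_congr rfl fun i _ => ?_
    rw [Finset.sum_comm]
  refine ⟨r, A, hK, fun z => ?_⟩
  have h := hΦ.tracePreserving (ketbra z)
  rw [hK, Matrix.trace_sum] at h
  simp only [conj_ketbra, trace_ketbra] at h
  exact_mod_cast h

/-! ### Dilations of families of states -/

/-- The states `ρ k` have purifications `V · (k, ·)`, with reference system `R` on the side of `Z`,
such that the operator `∑ |k⟩⟨k'| ⊗ Tr_F |V k⟩⟨V k'|` is bounded by `c` in the norm dual to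
`ProdBounded`. -/
def HasBoundedDilation {κ F Z : Type*} [Fintype κ] [Fintype F] [Fintype Z]
    (ρ : κ → Matrix (F × Z) (F × Z) ℂ) (c : ℝ) : Prop :=
  ∃ (R : Type) (_ : Fintype R) (V : F → κ × (R × Z) → ℂ),
    (∀ k f f' z z', ρ k (f, z) (f', z') = ∑ a, V f (k, (a, z)) * star (V f' (k, (a, z')))) ∧
    ∀ Y : Matrix (κ × (R × Z)) (κ × (R × Z)) ℂ, Y.PosSemidef → ProdBounded Y →
      ∑ f, quad Y (V f) ≤ c

lemma hasBoundedDilation_const {κ F Z : Type*} [Fintype κ] [Fintype F] [Unique F] [Fintype Z]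
    {τ : Matrix Z Z ℂ} (hτ : IsDensity τ) :
    HasBoundedDilation (fun _ : κ => Matrix.of fun p q : F × Z => τ p.2 q.2)
      (Fintype.card κ) := by
  obtain ⟨⟨m, v, rfl⟩, h1⟩ := hτ.imp_left exists_eq_sum_ketbra
  refine ⟨Fin m, inferInstance, fun _ => tensorVec 1 fun p => v p.1 p.2, ?_, ?_⟩
  · intro k f f' z z'
    simp [Matrix.sum_apply, ketbra, Matrix.vecMulVec_apply, tensorVec]
  · intro Y _ hY
    rw [Fintype.sum_unique]
    refine (hY _ _).trans_eq ?_
    simp only [Matrix.trace_sum, trace_ketbra] at h1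
    have h1' : ∑ i, normSq (v i) = 1 := by exact_mod_cast h1
    rw [normSq_prod, h1', mul_one]
    simp [normSq]

/-- The Kraus index is kept in the reader's reference system. The dilated channel is then an
isometry acting on `RZ` alone, and conjugating a test operator by it preserves product-boundedness.
-/
lemma HasBoundedDilation.ampliation {κ F Z Z' : Type*} [Fintype κ] [Fintype F] [Fintype Z]
    [Fintype Z'] {ρ : κ → Matrix (F × Z) (F × Z) ℂ} {c : ℝ} (h : HasBoundedDilation ρ c)
    {Φ : Matrix Z Z ℂ →ₗ[ℂ] Matrix Z' Z' ℂ} (hΦ : IsChannel Φ) :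
    HasBoundedDilation (fun k => ampliation Φ (ρ k)) c := by
  classical
  obtain ⟨R, _, V, hV, hc⟩ := h
  obtain ⟨r, A, hA, hA1⟩ := hΦ.exists_kraus
  let W : Matrix ((R × Fin r) × Z') (R × Z) ℂ :=
    Matrix.of fun p q => if p.1.1 = q.1 then A p.1.2 p.2 q.2 else 0
  have hWa : ∀ w a s z', W.mulVec w ((a, s), z') = (A s).mulVec (fun z => w (a, z)) z' :=
    fun w a s z' => by
      simp [W, Matrix.mulVec, dotProduct, Fintype.sum_prod_type]
  have hW : IsContraction W := fun w => by
    rw [normSq_prod, normSq_prod, Fintype.sum_prod_type]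
    simp only [hWa]
    exact (Finset.sum_congr rfl fun a _ => hA1 fun z => w (a, z)).le
  have h1 : IsContraction (1 : Matrix κ κ ℂ) := fun z => by rw [Matrix.one_mulVec]
  refine ⟨R × Fin r, inferInstance,
    fun f => ((1 : Matrix κ κ ℂ) ⊗ₖ W).mulVec (V f), ?_, ?_⟩
  · have hk : ∀ f k a s z', ((1 : Matrix κ κ ℂ) ⊗ₖ W).mulVec (V f) (k, ((a, s), z')) =
        (A s).mulVec (fun z => V f (k, (a, z))) z' := fun f k a s z' => by
      simp [W, Matrix.mulVec, dotProduct, Fintype.sum_prod_type, Matrix.one_apply]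
    intro k f f' z z'
    have hblock : (Matrix.of fun i j => ρ k (f, i) (f', j)) = ∑ a, Matrix.vecMulVec
        (fun z => V f (k, (a, z))) (star fun z => V f' (k, (a, z))) := by
      ext i j
      simp [hV, Matrix.sum_apply, Matrix.vecMulVec_apply]
    simp only [PrivateReading.ampliation, Matrix.of_apply]
    rw [hblock, hA]
    simp only [Matrix.mul_sum, Matrix.sum_mul, conj_vecMulVec, Matrix.sum_apply,
      Matrix.vecMulVec_apply, Pi.star_apply, Fintype.sum_prod_type, hk]
    exact Finset.sum_comm
  · intro Y hY0 hY
    simp only [← quad_conj]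
    exact hc _ (hY0.conjTranspose_mul_mul_same _) (hY.conj h1 hW)

lemma trace_conjTranspose_mul {I J : Type*} [Fintype I] [Fintype J] (M N : Matrix I J ℂ) :
    (M.conjTranspose * N).trace =
      star (fun p : I × J => M p.1 p.2) ⬝ᵥ fun p : I × J => N p.1 p.2 := by
  simp [Matrix.trace, Matrix.mul_apply, dotProduct, Fintype.sum_prod_type_right]

lemma normSq_eq_of_mul_self_eq {I J : Type*} [Fintype I] [Fintype J] {P : Matrix J J ℂ}
    {M : Matrix I J ℂ} (hP : P.IsHermitian) (h : P * P = M.conjTranspose * M) :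
    normSq (fun p : J × J => P p.1 p.2) = normSq fun p : I × J => M p.1 p.2 := by
  have h1 := trace_conjTranspose_mul P P
  rw [hP.eq, h, trace_conjTranspose_mul, dotProduct_star_self, dotProduct_star_self] at h1
  exact_mod_cast h1.symm

section ChannelUse

variable {κ X B' B E L R : Type*} [Fintype κ] [DecidableEq κ] [Fintype B'] [Fintype L]
  [DecidableEq L] [Fintype R] [DecidableEq R]

/-- The operator `∑_k |k⟩⟨k| ⊗ ⟨e|_E U^{x k}` acting as the identity on `R` and `L`. -/
def controlledBlock (U : X → Matrix (B × E) B' ℂ) (x : κ → X) (e : E) :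
    Matrix (κ × (R × (L × B))) (κ × (R × (L × B'))) ℂ :=
  Matrix.of fun p q => if p.1 = q.1 ∧ p.2.1 = q.2.1 ∧ p.2.2.1 = q.2.2.1 then
    U (x p.1) (p.2.2.2, e) q.2.2.2 else 0

lemma controlledBlock_mulVec (U : X → Matrix (B × E) B' ℂ) (x : κ → X) (e : E)
    (z : κ × (R × (L × B')) → ℂ) (k : κ) (a : R) (l : L) (b : B) :
    (controlledBlock U x e).mulVec z (k, (a, (l, b))) =
      ∑ b', U (x k) (b, e) b' * z (k, (a, (l, b'))) := by
  simp [controlledBlock, Matrix.mulVec, dotProduct, Fintype.sum_prod_type, ite_and]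

variable [Fintype X] [DecidableEq X] [Fintype B] [DecidableEq B] [Fintype E]

/-- The definition of the bidirectional quantity only allows references of the size of the inputs.
Polar decomposition compresses `κ` and `RL` to that size, and the contractions that undo the
compression are absorbed into `Y`. -/
lemma ProdBounded.sum_quad_controlledBlock_le {U : X → Matrix (B × E) B' ℂ} {t : ℝ}
    (hR : bidirectionalMaxRelEntanglement (controlledChannel U) < t) (x : κ → X)
    {Y : Matrix (κ × (R × (L × B))) (κ × (R × (L × B))) ℂ} (hY : ProdBounded Y)
    (hY0 : Y.PosSemidef) (u : κ → ℂ) (w : R × (L × B') → ℂ) :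
    ∑ e, quad Y ((controlledBlock U x e).mulVec (tensorVec u w)) ≤
      2 ^ t * (normSq u * normSq w) := by
  -- The vector `∑_k u_k |k⟩|x_k⟩`, written as a matrix; its polar part `P` is a vector of the same
  -- norm on `X × X`.
  let u' : Matrix κ X ℂ := Matrix.of fun k y => if y = x k then u k else 0
  let w' : Matrix (R × L) B' ℂ := Matrix.of fun p b' => w (p.1, (p.2, b'))
  obtain ⟨F, P, hP, hPP, huP, -, hF, -⟩ := exists_polar u'
  obtain ⟨H, Q, hQ, hQQ, hwQ, -, hH, -⟩ := exists_polar w'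
  -- `F` restores the register `κ`; keeping only the component `x k` then erases the copy of the
  -- letter that was fed into the channel.
  let G : Matrix κ (X × X) ℂ := Matrix.of fun k p => if p.2 = x k then F k p.1 else 0
  let H' : Matrix (R × (L × B)) (B × B') ℂ :=
    Matrix.of fun p q => if p.2.2 = q.1 then H (p.1, p.2.1) q.2 else 0
  have hGa : ∀ z k, G.mulVec z k = F.mulVec (fun s => z (s, x k)) k := fun z k => by
    simp [G, Matrix.mulVec, dotProduct, Fintype.sum_prod_type]
  have hHa : ∀ z a l b, H'.mulVec z (a, (l, b)) = H.mulVec (fun s => z (b, s)) (a, l) :=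
    fun z a l b => by
      simp [H', Matrix.mulVec, dotProduct, Fintype.sum_prod_type]
  have hG : IsContraction G := fun z => by
    calc normSq (G.mulVec z) = ∑ k, ‖F.mulVec (fun s => z (s, x k)) k‖ ^ 2 := by
          simp only [normSq, hGa]
      _ ≤ ∑ k, ∑ y, ‖F.mulVec (fun s => z (s, y)) k‖ ^ 2 := Finset.sum_le_sum fun k _ =>
          Finset.single_le_sum (f := fun y => ‖F.mulVec (fun s => z (s, y)) k‖ ^ 2)
            (fun _ _ => by positivity) (Finset.mem_univ (x k))
      _ = ∑ y, normSq (F.mulVec fun s => z (s, y)) := Finset.sum_comm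
      _ ≤ ∑ y, normSq fun s => z (s, y) := Finset.sum_le_sum fun y _ => hF _
      _ = normSq z := (normSq_prod_right z).symm
  have hH' : IsContraction H' := fun z => by
    calc normSq (H'.mulVec z) =
          normSq fun p : (R × L) × B => H'.mulVec z (p.1.1, (p.1.2, p.2)) :=
          ((Equiv.prodAssoc R L B).sum_comp fun p => ‖H'.mulVec z p‖ ^ 2).symm
      _ = ∑ b, normSq (H.mulVec fun s => z (b, s)) := by
          rw [normSq_prod_right]
          simp only [hHa]
      _ ≤ ∑ b, normSq fun s => z (b, s) := Finset.sum_le_sum fun b _ => hH _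
      _ = normSq z := (normSq_prod z).symm
  let ψ : X × X → ℂ := fun p => P p.1 p.2
  -- The indices are swapped because the channel input `B'` comes before the reference in `φ`.
  let φ : B' × B' → ℂ := fun p => Q p.2 p.1
  have hψ : normSq ψ = normSq u := by
    rw [normSq_eq_of_mul_self_eq hP.isHermitian hPP, normSq_prod]
    refine Finset.sum_congr rfl fun k _ => ?_
    simp [normSq, u', apply_ite]
  have hφ : normSq φ = normSq w := by
    have h1 : normSq φ = normSq fun p : B' × B' => Q p.1 p.2 := by
      rw [normSq_prod, normSq_prod_right]
    rw [h1, normSq_eq_of_mul_self_eq hQ.isHermitian hQQ]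
    simp [normSq, w', Fintype.sum_prod_type]
  have key : ∀ e, (controlledBlock U x e).mulVec (tensorVec u w) =
      (G ⊗ₖ H').mulVec (controlledOutput U ψ φ e) := fun e => by
    ext ⟨k, a, l, b⟩
    have hu : u k = ∑ s, F k s * P s (x k) := by
      have := congrFun (congrFun huP k) (x k)
      simpa [u', Matrix.mul_apply] using this
    have hw : ∀ b', w (a, (l, b')) = ∑ s, H (a, l) s * Q s b' := fun b' => by
      have := congrFun (congrFun hwQ (a, l)) b'
      simpa [w', Matrix.mul_apply] using this
    have hGH : ∀ y, (G ⊗ₖ H').mulVec y (k, (a, (l, b))) =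
        ∑ s, ∑ t, F k s * H (a, l) t * y ((s, x k), (b, t)) := fun y => by
      simp [G, H', Matrix.mulVec, dotProduct, Fintype.sum_prod_type]
    rw [controlledBlock_mulVec, hGH]
    simp only [tensorVec, hu, hw, controlledOutput, ψ, φ, Finset.sum_mul_sum]
    simp only [Finset.mul_sum]
    rw [Finset.sum_comm]
    refine Finset.sum_congr rfl fun s _ => ?_
    rw [Finset.sum_comm]
    exact Finset.sum_congr rfl fun t _ => Finset.sum_congr rfl fun b' _ => by ring
  simp only [key, ← quad_conj]
  refine ((hY.conj hG hH').sum_quad_controlledOutput_le hR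
    (hY0.conjTranspose_mul_mul_same _) ψ φ).trans_eq ?_
  rw [hψ, hφ]

/-- Argue in the Heisenberg picture: pulling a test operator back through the call and dividing by
`2^t` gives an admissible test operator again, to which the bound before the call applies. -/
lemma HasBoundedDilation.channelUse {U : X → Matrix (B × E) B' ℂ} {t c : ℝ}
    (ht : bidirectionalMaxRelEntanglement (controlledChannel U) < t) (x : κ → X) {i : ℕ}
    {ρ : κ → Matrix ((Fin i → E) × (L × B')) ((Fin i → E) × (L × B')) ℂ}
    (h : HasBoundedDilation ρ c) :
    HasBoundedDilation (fun k => channelUse (conjChannel (U (x k))) (ρ k)) (2 ^ t * c) := by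
  classical
  obtain ⟨R, _, V, hV, hc⟩ := h
  refine ⟨R, inferInstance,
    fun g => (controlledBlock U x (g (Fin.last i))).mulVec (V (Fin.init g)), ?_, ?_⟩
  · rintro k g g' ⟨l, b⟩ ⟨l', b'⟩
    have hblock : (Matrix.of fun y z => ρ k (Fin.init g, (l, y)) (Fin.init g', (l', z))) =
        ∑ a, Matrix.vecMulVec (fun z => V (Fin.init g) (k, (a, (l, z))))
          (star fun z => V (Fin.init g') (k, (a, (l', z)))) := by
      ext i j
      simp [hV, Matrix.sum_apply, Matrix.vecMulVec_apply]
    simp only [PrivateReading.channelUse, Matrix.of_apply, conjChannel, LinearMap.coe_mk,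
      AddHom.coe_mk]
    rw [hblock]
    simp only [Matrix.mul_sum, Matrix.sum_mul, conj_vecMulVec, Matrix.sum_apply,
      Matrix.vecMulVec_apply, Pi.star_apply, controlledBlock_mulVec]
    rfl
  · intro Y hY0 hY
    have hpos : (0 : ℝ) < 2 ^ t := by positivity
    -- Separate the new output `e` from the eavesdropper's earlier systems.
    rw [← (Fin.snocEquiv fun _ => E).sum_comp, Fintype.sum_prod_type_right]
    simp only [Fin.snocEquiv, Equiv.coe_fn_mk, Fin.snoc_last, Fin.init_snoc]
    let D : E → Matrix (κ × (R × (L × B))) (κ × (R × (L × B'))) ℂ := controlledBlock U x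
    have h1 := hc ((2 ^ t : ℝ)⁻¹ • ∑ e, (D e).conjTranspose * Y * D e)
      ((Matrix.posSemidef_sum _ fun e _ => hY0.conjTranspose_mul_mul_same _).smul
        (inv_nonneg.mpr hpos.le)) fun u w => by
      simp only [quad_smul_left, quad_sum, quad_conj]
      rw [inv_mul_le_iff₀ hpos]
      exact hY.sum_quad_controlledBlock_le ht x hY0 u w
    simp only [quad_smul_left, quad_sum, quad_conj, ← Finset.mul_sum] at h1
    rwa [inv_mul_le_iff₀ hpos] at h1

end ChannelUse

/-! ### Decoding and security of a family of states with a bounded dilation -/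

/-- The polar part of the matrix with rows `⟨v_s|` is the square root of `∑_s |v_s⟩⟨v_s|`. -/
lemma exists_posSemidef_mul_self {I : Type*} [Fintype I] {ρ : Matrix I I ℂ} (h : ρ.PosSemidef) :
    ∃ A : Matrix I I ℂ, A.PosSemidef ∧ A * A = ρ := by
  obtain ⟨m, v, rfl⟩ := exists_eq_sum_ketbra h
  obtain ⟨-, P, hP, hPP, -⟩ := exists_polar (Matrix.of fun (s : Fin m) i => star (v s i))
  refine ⟨P, hP, hPP.trans ?_⟩
  ext i j
  simp [Matrix.mul_apply, Matrix.sum_apply, ketbra, Matrix.vecMulVec_apply]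

lemma IsContraction.transpose_of_isHermitian {I : Type*} [Fintype I] {G : Matrix I I ℂ}
    (hG : IsContraction G) (h : G.IsHermitian) : IsContraction G.transpose := fun z => by
  have h1 : G.transpose.mulVec z = star (G.mulVec (star z)) := by
    rw [Matrix.star_mulVec, star_star, h.eq, Matrix.mulVec_transpose]
  have h2 : ∀ y : I → ℂ, normSq (star y) = normSq y := fun y => by simp [normSq]
  rw [h1, h2, ← h2 z]
  exact hG _

lemma IsContraction.neg {I : Type*} [Fintype I] {G : Matrix I I ℂ}
    (hG : IsContraction G) : IsContraction (-G) := fun z => by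
  have h2 : ∀ y : I → ℂ, normSq (-y) = normSq y := fun y => by simp [normSq]
  rw [Matrix.neg_mulVec, h2]
  exact hG z

/-- A lower bound on the overlap `Tr √τ √ω` where `ω ≤ N`. -/
lemma re_trace_mul_ge {I : Type*} [Fintype I] [DecidableEq I] {A P N τ : Matrix I I ℂ}
    (hA : A.PosSemidef) (hP : P.PosSemidef) (hτ : τ.trace = 1) (hN : N.trace = 1)
    (hAA : A * A = τ.transpose) (hPN : (N.transpose - P * P).PosSemidef) :
    (P * P).trace.re - 1 / 2 * traceNorm (N - τ) ≤ (A * P).trace.re := by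
  -- The left side of Powers–Størmer is `1 + Tr P² - 2 Tr AP`. On the right, `A² - P²` splits into
  -- `τᵀ - Nᵀ`, which costs the trace norm, and `Nᵀ - P² ≥ 0`, which costs its trace `1 - Tr P²`.
  obtain ⟨G, hG, hGH, h⟩ := exists_isContraction_re_trace_sub_mul_sub_le hA hP
  have h1 := (hG.transpose_of_isHermitian hGH).neg.re_trace_mul_le_traceNorm (N - τ)
  have h2 := hG.re_trace_mul_le hPN
  have h3 : (-G.transpose * (N - τ)).trace = (G * (τ.transpose - N.transpose)).trace := by
    rw [← Matrix.trace_transpose, Matrix.transpose_mul, Matrix.trace_mul_comm]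
    simp [Matrix.mul_sub]
  have h4 : G * (A * A - P * P) =
      G * (τ.transpose - N.transpose) + G * (N.transpose - P * P) := by
    rw [hAA, ← mul_add]; simp
  have h5 : ((A - P) * (A - P)).trace = 1 + (P * P).trace - 2 * (A * P).trace := by
    rw [mul_sub, sub_mul, sub_mul, Matrix.trace_sub, Matrix.trace_sub, Matrix.trace_sub,
      hAA, Matrix.trace_transpose, hτ, Matrix.trace_mul_comm P A]
    ring
  rw [h3] at h1
  rw [h4, h5, Matrix.trace_add] at h
  rw [Matrix.trace_sub, Matrix.trace_transpose, hN] at h2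
  simp only [Complex.add_re, Complex.sub_re, Complex.one_re, Complex.mul_re, Complex.re_ofNat,
    Complex.im_ofNat, zero_mul, sub_zero] at h h2
  linarith

lemma trace_one_kronecker_mul {R Z : Type*} [Fintype R] [DecidableEq R] [Fintype Z]
    (Λ : Matrix Z Z ℂ) (Q : Matrix (R × Z) (R × Z) ℂ) :
    (((1 : Matrix R R ℂ) ⊗ₖ Λ) * Q).trace = (Λ * traceFst Q).trace := by
  simp only [Matrix.trace, Matrix.diag, Matrix.mul_apply, Matrix.kroneckerMap_apply,
    Fintype.sum_prod_type, Matrix.one_apply, ite_mul, one_mul, zero_mul, traceFst,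
    Matrix.of_apply, Finset.sum_ite_irrel, Finset.sum_const_zero, Finset.sum_ite_eq,
    Finset.mem_univ, if_true, Finset.mul_sum]
  rw [Finset.sum_comm]
  exact Finset.sum_congr rfl fun z _ => Finset.sum_comm

/-- If a measurement identifies `k` from the `Z` parts and the `F` parts are close to a fixed
state, then the bound `c` is large. -/
lemma HasBoundedDilation.sum_le_sqrt {κ F Z : Type*} [Fintype κ] [Fintype F] [DecidableEq F]
    [Fintype Z] [DecidableEq Z] {ρ : κ → Matrix (F × Z) (F × Z) ℂ} {c : ℝ}
    (h : HasBoundedDilation ρ c) (hρ : ∀ k, (ρ k).trace = 1) {Λ : κ → Matrix Z Z ℂ}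
    (hΛ : ∀ k, (Λ k).PosSemidef) (hsum : ∑ k, Λ k = 1) {τ : Matrix F F ℂ} (hτ : IsDensity τ) :
    ∑ k, ((Λ k * traceFst (ρ k)).trace.re - 1 / 2 * traceNorm (traceSnd (ρ k) - τ)) ≤ √c := by
  classical
  obtain ⟨R, _, V, hV, hc⟩ := h
  choose A hA hAA using fun k => exists_posSemidef_mul_self (hΛ k)
  obtain ⟨S, hS, hSS⟩ := exists_posSemidef_mul_self hτ.1.transpose
  let V' : κ → Matrix (R × Z) F ℂ := fun k => Matrix.of fun p f => V f (k, p)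
  let B : κ → Matrix (R × Z) (R × Z) ℂ := fun k => (1 : Matrix R R ℂ) ⊗ₖ A k
  have hBB : ∀ k, (B k).conjTranspose * B k = (1 : Matrix R R ℂ) ⊗ₖ Λ k := fun k => by
    rw [Matrix.conjTranspose_kronecker, ← Matrix.mul_kronecker_mul, (hA k).isHermitian.eq, hAA,
      Matrix.conjTranspose_one, Matrix.one_mul]
  have hBsum : ∑ k, (B k).conjTranspose * B k = 1 := by
    simp only [hBB]
    rw [← Matrix.one_kronecker_one, ← hsum]
    ext p q
    simp [Matrix.sum_apply, Finset.mul_sum]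
  choose W P hP hPP hM hWM hW hW' using fun k => exists_polar (B k * V' k)
  -- The blocks `W_k† B_k` turn the dilation of message `k` into `P_k`; summing over `k` without a
  -- record of it makes the `P_k` add coherently.
  let T : Matrix F (κ × (R × Z)) ℂ :=
    Matrix.of fun f p => ((W p.1).conjTranspose * B p.1) f p.2
  have hTV : ∀ f, T.mulVec (V f) = ∑ k, (P k).col f := fun f => by
    ext g
    simp only [← hWM, ← Matrix.mul_assoc, Finset.sum_apply, Matrix.col_apply, Matrix.mulVec,
      dotProduct, Fintype.sum_prod_type (α₁ := κ), T, V', Matrix.of_apply]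
    exact Finset.sum_congr rfl fun k _ => by rw [Matrix.mul_apply]; rfl
  have hT : ProdBounded (T.conjTranspose * T) := fun u w => by
    rw [quad_conjTranspose_mul_self]
    have e1 : T.mulVec (tensorVec u w) =
        ∑ k, u k • ((W k).conjTranspose * B k).mulVec w := by
      ext g
      simp only [Finset.sum_apply, Matrix.mulVec, dotProduct, Fintype.sum_prod_type (α₁ := κ), T,
        Matrix.of_apply, tensorVec, Pi.smul_apply, smul_eq_mul, Finset.mul_sum]
      exact Finset.sum_congr rfl fun k _ => Finset.sum_congr rfl fun p _ => by ring
    have e2 : ∑ k, normSq ((B k).mulVec w) = normSq w := by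
      apply Complex.ofReal_injective
      rw [Complex.ofReal_sum]
      simp only [normSq_mulVec]
      rw [← dotProduct_sum, ← Matrix.sum_mulVec, hBsum, Matrix.one_mulVec, dotProduct_star_self]
    have e3 : √(normSq (T.mulVec (tensorVec u w))) ≤ √(normSq u * normSq w) := by
      rw [e1]
      -- Cauchy–Schwarz in `k` suffices because completeness of the measurement gives `∑_k ‖B_k w‖²
      -- = ‖w‖²`.
      refine (sqrt_normSq_sum_le _ _).trans ?_
      calc _ ≤ ∑ k, ‖u k‖ * √(normSq ((B k).mulVec w)) := Finset.sum_le_sum fun k _ => by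
            rw [normSq_smul, Real.sqrt_mul (by positivity), Real.sqrt_sq (norm_nonneg _),
              ← Matrix.mulVec_mulVec]
            exact mul_le_mul_of_nonneg_left (Real.sqrt_le_sqrt (hW' k _)) (norm_nonneg _)
        _ ≤ √(∑ k, ‖u k‖ ^ 2) * √(∑ k, √(normSq ((B k).mulVec w)) ^ 2) :=
            Real.sum_mul_le_sqrt_mul_sqrt _ _ _
        _ = √(normSq u * normSq w) := by
            simp only [Real.sq_sqrt (normSq_nonneg _), e2]
            exact (Real.sqrt_mul (normSq_nonneg u) _).symm
    exact (Real.sqrt_le_sqrt_iff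
      (mul_nonneg (normSq_nonneg _) (normSq_nonneg _))).mp e3
  have hbound := hc _ (Matrix.posSemidef_conjTranspose_mul_self T) hT
  simp only [quad_conjTranspose_mul_self, hTV] at hbound
  have hN : ∀ k, (traceSnd (ρ k)).transpose = (V' k).conjTranspose * V' k := fun k => by
    ext f f'
    simp only [traceSnd, Matrix.transpose_apply, Matrix.of_apply, hV, Matrix.mul_apply,
      Matrix.conjTranspose_apply, V', Fintype.sum_prod_type]
    rw [Finset.sum_comm]
    exact Finset.sum_congr rfl fun a _ => Finset.sum_congr rfl fun z _ => mul_comm _ _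
  have hPB : ∀ k, P k * P k = (V' k).conjTranspose * ((B k).conjTranspose * B k) * V' k :=
    fun k => by rw [hPP, Matrix.conjTranspose_mul]; simp only [Matrix.mul_assoc]
  have hk : ∀ k, (Λ k * traceFst (ρ k)).trace.re - 1 / 2 * traceNorm (traceSnd (ρ k) - τ) ≤
      (S * P k).trace.re := fun k => by
    have e1 : (Λ k * traceFst (ρ k)).trace = (P k * P k).trace := by
      have e2 : traceFst (ρ k) = traceFst (V' k * (V' k).conjTranspose) := by
        ext z z'
        simp only [traceFst, Matrix.of_apply, hV, Matrix.mul_apply, Matrix.conjTranspose_apply, V']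
        exact Finset.sum_comm
      rw [hPB, hBB, Matrix.mul_assoc, Matrix.trace_mul_comm (V' k).conjTranspose,
        Matrix.mul_assoc, trace_one_kronecker_mul, e2]
    rw [e1]
    refine re_trace_mul_ge hS (hP k) hτ.2 ?_ hSS ?_
    · rw [← hρ k]
      simp [Matrix.trace, traceSnd, Fintype.sum_prod_type]
    -- The difference is the contribution of the other outcomes `j ≠ k`, hence positive.
    · have : (traceSnd (ρ k)).transpose - P k * P k =
          ∑ j ∈ Finset.univ.erase k,
            (V' k).conjTranspose * ((B j).conjTranspose * B j) * V' k := by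
        rw [hN, hPB, Finset.sum_erase_eq_sub (Finset.mem_univ k), ← Matrix.sum_mul,
          ← Matrix.mul_sum, hBsum, Matrix.mul_one]
      rw [this]
      exact Matrix.posSemidef_sum _ fun j _ =>
        (Matrix.posSemidef_conjTranspose_mul_self _).conjTranspose_mul_mul_same _
  refine (Finset.sum_le_sum fun k _ => hk k).trans ?_
  rw [← Complex.re_sum, ← Matrix.trace_sum, ← Matrix.mul_sum]
  have e1 := trace_conjTranspose_mul S (∑ k, P k)
  rw [hS.isHermitian.eq] at e1
  rw [e1]
  -- Cauchy–Schwarz for the Hilbert–Schmidt inner product, where `S = √τᵀ` has norm one.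
  refine (Complex.re_le_norm _).trans ((norm_dotProduct_le _ _).trans ?_)
  have e2 : normSq (fun p : F × F => S p.1 p.2) = 1 := by
    have := trace_conjTranspose_mul S S
    rw [hS.isHermitian.eq, hSS, Matrix.trace_transpose, hτ.2, dotProduct_star_self] at this
    exact_mod_cast this.symm
  rw [e2, Real.sqrt_one, one_mul]
  refine Real.sqrt_le_sqrt ((normSq_prod_right _).le.trans (le_of_eq_of_le ?_ hbound))
  refine Finset.sum_congr rfl fun f _ => ?_
  congr 1
  ext g
  simp [Matrix.sum_apply]

/-! ### Traces -/

lemma trace_ampliation {F I O : Type*} [Fintype F] [Fintype I] [Fintype O]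
    {Φ : Matrix I I ℂ →ₗ[ℂ] Matrix O O ℂ} (hΦ : ∀ σ, (Φ σ).trace = σ.trace)
    (ρ : Matrix (F × I) (F × I) ℂ) : (ampliation Φ ρ).trace = ρ.trace := by
  simp only [Matrix.trace, Fintype.sum_prod_type]
  exact Finset.sum_congr rfl fun f _ => hΦ (Matrix.of fun i j => ρ (f, i) (f, j))

lemma trace_channelUse {B' B E L : Type*} [Fintype B'] [Fintype B] [Fintype E] [Fintype L] {i : ℕ}
    {M : Matrix B' B' ℂ →ₗ[ℂ] Matrix (B × E) (B × E) ℂ} (hM : ∀ σ, (M σ).trace = σ.trace)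
    (ρ : Matrix ((Fin i → E) × (L × B')) ((Fin i → E) × (L × B')) ℂ) :
    (channelUse M ρ).trace = ρ.trace := by
  have h : ∀ (f : Fin i → E) (l : L), ∑ b, ∑ e,
      M (Matrix.of fun y z => ρ (f, (l, y)) (f, (l, z))) (b, e) (b, e) =
        ∑ y, ρ (f, (l, y)) (f, (l, y)) := fun f l => by
    have := hM (Matrix.of fun y z => ρ (f, (l, y)) (f, (l, z)))
    simpa only [Matrix.trace, Matrix.diag, Fintype.sum_prod_type, Matrix.of_apply] using this
  simp only [Matrix.trace, Matrix.diag, Fintype.sum_prod_type]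
  rw [← (Fin.snocEquiv fun _ => E).sum_comp, Fintype.sum_prod_type_right]
  simp only [Fin.snocEquiv, Equiv.coe_fn_mk, channelUse, Matrix.of_apply, Fin.snoc_last,
    Fin.init_snoc]
  refine Finset.sum_congr rfl fun f _ => ?_
  rw [Finset.sum_comm]
  refine Finset.sum_congr rfl fun l _ => ?_
  rw [Finset.sum_comm]
  exact h f l

lemma trace_conjChannel {I O : Type*} [Fintype I] [DecidableEq I] [Fintype O] {V : Matrix O I ℂ}
    (hV : V.conjTranspose * V = 1) (σ : Matrix I I ℂ) : (conjChannel V σ).trace = σ.trace := by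
  change (V * σ * V.conjTranspose).trace = σ.trace
  rw [Matrix.trace_mul_comm, ← Matrix.mul_assoc, hV, Matrix.one_mul]

/-! ### The strong converse bound -/

section Protocol

variable {X B' B E : Type*} [Fintype B'] [Fintype B] [DecidableEq B] [Fintype E]
  {U : X → Matrix (B × E) B' ℂ}

lemma AdaptiveStrategy.trace_inputState [DecidableEq B'] (hU : ∀ x, (U x).conjTranspose * U x = 1) {m K : ℕ}
    (S : AdaptiveStrategy B' B m K) (w : Fin (m + 1) → X) : ∀ (i : ℕ) (hi : i ≤ m),
      (S.inputState (fun x => conjChannel (U x)) w i hi).trace = 1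
  | 0, _ => by
    rw [← S.transmitter_isDensity.2]
    simp [inputState, Matrix.trace, Fintype.sum_prod_type]
  | i + 1, hi => by
    rw [inputState, trace_ampliation (S.adapt_isChannel i hi).tracePreserving,
      trace_channelUse (trace_conjChannel (hU _)), trace_inputState hU S w i]

variable [Fintype X] [DecidableEq X]

lemma AdaptiveStrategy.hasBoundedDilation_inputState {t : ℝ}
    (ht : bidirectionalMaxRelEntanglement (controlledChannel U) < t) {m K : ℕ}
    (S : AdaptiveStrategy B' B m K) (w : Fin K → Fin (m + 1) → X) : ∀ (i : ℕ) (hi : i ≤ m),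
      HasBoundedDilation (fun k => S.inputState (fun x => conjChannel (U x)) (w k) i hi)
        (2 ^ (i * t) * K)
  | 0, _ => by
    simpa [inputState] using
      hasBoundedDilation_const (κ := Fin K) (F := Fin 0 → E) S.transmitter_isDensity
  | i + 1, hi => by
    have h := ((hasBoundedDilation_inputState ht S w i (by omega)).channelUse ht
      fun k => w k ⟨i, by omega⟩).ampliation (S.adapt_isChannel i hi)
    have e : (2 : ℝ) ^ (((i + 1 : ℕ) : ℝ) * t) * K = 2 ^ t * (2 ^ (i * t) * K) := by
      rw [← mul_assoc, ← Real.rpow_add two_pos]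
      push_cast
      ring_nf
    rw [e]
    exact h

/-- The number of messages of a protocol is at most `2^{nt} / (1 - ε - δ)²`. -/
lemma PrivateReadingProtocol.mul_sq_le [DecidableEq B'] [DecidableEq E]
    (hU : ∀ x, (U x).conjTranspose * U x = 1) {t : ℝ}
    (ht : bidirectionalMaxRelEntanglement (controlledChannel U) < t) {m K : ℕ} {ε δ : ℝ}
    (hεδ : ε + δ < 1) (hK : 0 < K)
    (P : PrivateReadingProtocol (fun x => conjChannel (U x)) m K ε δ) :
    K * (1 - ε - δ) ^ 2 ≤ (2 : ℝ) ^ (((m + 1 : ℕ) : ℝ) * t) := by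
  set S := P.strategy
  have h := (S.hasBoundedDilation_inputState ht P.encoder m le_rfl).channelUse ht
    fun k => P.encoder k (Fin.last m)
  have e : (2 : ℝ) ^ t * (2 ^ (m * t) * K) = 2 ^ (((m + 1 : ℕ) : ℝ) * t) * K := by
    rw [← mul_assoc, ← Real.rpow_add two_pos]
    push_cast
    ring_nf
  rw [e] at h
  have h1 := h.sum_le_sqrt (fun k => by
    rw [trace_channelUse (trace_conjChannel (hU _)), S.trace_inputState hU])
    S.meas_posSemidef S.meas_sum P.eveState_isDensity
  have hs := P.success
  have hp := P.security
  have hK' : (0 : ℝ) < K := by exact_mod_cast hK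
  rw [one_div, le_inv_mul_iff₀ hK'] at hs
  rw [one_div, inv_mul_le_iff₀ hK'] at hp
  rw [Finset.sum_sub_distrib] at h1
  have h2 : K * (1 - ε - δ) ≤ √((2 : ℝ) ^ (((m + 1 : ℕ) : ℝ) * t) * K) := by
    refine le_trans ?_ h1
    refine le_trans (b := K * (1 - ε) - K * δ) (by linarith) (sub_le_sub hs hp)
  -- Squaring is legitimate since `ε + δ < 1`; one factor `K` then cancels.
  have h3 := (Real.le_sqrt' (mul_pos hK' (by linarith))).mp h2
  have h4 : K * (K * (1 - ε - δ) ^ 2) ≤ K * (2 : ℝ) ^ (((m + 1 : ℕ) : ℝ) * t) := by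
    linarith
  exact le_of_mul_le_mul_left h4 hK'

/-- A protocol with at least `2^{n(t + δ')}` messages would give `2^{nδ'} (1-ε-δ)² ≤ 1`, which fails
for large `n`. -/
lemma isStrongConverseRate_of_lt [DecidableEq B'] [DecidableEq E]
    (hU : ∀ x, (U x).conjTranspose * U x = 1) {t : ℝ}
    (ht : bidirectionalMaxRelEntanglement (controlledChannel U) < t) :
    IsStrongConverseRate (fun x => conjChannel (U x)) t := by
  intro ε δ hε hδ hεδ δ' hδ'
  have hpos : 0 < (1 - ε - δ) ^ 2 := pow_pos (by linarith) 2
  have hlim : Filter.Tendsto (fun n : ℕ => (2 : ℝ) ^ ((n : ℝ) * δ')) Filter.atTop Filter.atTop := by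
    have : ∀ n : ℕ, (2 : ℝ) ^ ((n : ℝ) * δ') = ((2 : ℝ) ^ δ') ^ n := fun n => by
      rw [mul_comm, Real.rpow_mul two_pos.le, Real.rpow_natCast]
    simp only [this]
    exact tendsto_pow_atTop_atTop_of_one_lt (Real.one_lt_rpow one_lt_two hδ')
  filter_upwards [hlim.eventually_gt_atTop ((1 - ε - δ) ^ 2)⁻¹] with n hn K hK ⟨m, hm, ⟨P⟩⟩
  have hn2 : (0 : ℝ) < 2 ^ ((n : ℝ) * t) := by positivity
  have hK0 : 0 < K := by
    have : (0 : ℝ) < K := lt_of_lt_of_le (by positivity) hK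
    exact_mod_cast this
  have h := P.mul_sq_le hU ht (by linarith) hK0
  rw [← hm] at h
  rw [mul_add, Real.rpow_add two_pos] at hK
  rw [inv_lt_iff_one_lt_mul₀ hpos] at hn
  have h1 := mul_le_mul_of_nonneg_right hK hpos.le
  have h2 := mul_lt_mul_of_pos_left hn hn2
  linarith

end Protocol

end PrivateReading

end

theorem mainTheorem4 {X B' B E : Type*} [Fintype X] [DecidableEq X] [Fintype B']
    [DecidableEq B'] [Fintype B] [DecidableEq B] [Fintype E] [DecidableEq E]
    (U : X → Matrix (B × E) B' ℂ) (hU : ∀ x, (U x).conjTranspose * U x = 1) :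
    PrivateReading.strongConverseCapacity (fun x => PrivateReading.conjChannel (U x)) ≤
      PrivateReading.bidirectionalMaxRelEntanglement (PrivateReading.controlledChannel U) := by
  -- It suffices to compare with real `t` strictly above the right side; an infinite right side
  -- leaves nothing to check.
  refine EReal.le_of_forall_lt_iff_le.mp fun t ht => ?_
  exact iInf₂_le t (PrivateReading.isStrongConverseRate_of_lt hU ht)
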